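/- **Setting.** For a finite-dimensional real vector space $W$ let $\Lambda^{p,q}=\bigwedge^pW^*\otimes\bigwedge^qW^*$, the $(p+q)$-linear functionals on $W$ that are antisymmetric in the first $p$ and in the last $q$ arguments. Let $s\colon\Lambda^{p,q}\to\Lambda^{p+1,q-1}$ and $s^*\colon\Lambda^{p,q}\to\Lambda^{p-1,q+1}$ be $$(s\phi)(X_1,\dots,X_{p+1};Y_1,\dots,Y_{q-1})=\sum_{a=1}^{p+1}(-1)^{a-1}\phi(X_1,\dots,\widehat{X_a},\dots,X_{p+1};X_a,Y_1,\dots,Y_{q-1}),$$ $$(s^*\phi)(X_1,\dots,X_{p-1};Y_1,\dots,Y_{q+1})=\sum_{a=1}^{q+1}(-1)^{a-1}\phi(Y_a,X_1,\dots,X_{p-1};Y_1,\dots,\widehat{Y_a},\dots,Y_{q+1})$$ (spaces with a negative index are zero), and for an integer $m\ge0$ let $\Lambda^{p,q}_m$ be the eigenspace of $s^*s\colon\Lambda^{p,q}\to\Lambda^{p,q}$ with eigenvalue $m(m+p-q+1)$. Let $\mathcal T$ be a finite simplicial triangulation (simplicial complex), let $\mathfrak T$ be the set of its (nonempty) simplices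 of all dimensions, and let each simplex $F\in\mathfrak T$ carry a Euclidean metric, i.e. an inner product on its tangent space (for a triangulated polyhedral domain, the induced one). For $r\ge0$ let $\mathcal P_r\Lambda^{p,q}_m(F)$ be the space of $(p,q)$-forms on $F$ (fields of elements of $\Lambda^{p,q}$ of the tangent space of $F$) which have polynomial coefficients of degree at most $r$ and lie pointwise in $\Lambda^{p,q}_m$. For simplices $K\le F$ let $\operatorname{tr}^F_K$ denote the pullback under the inclusion $K\hookrightarrow F$. Let $\mathring{\mathcal P}_r\Lambda^{p,q}_m(F)$ be the subspace of those $\phi\in\mathcal P_r\Lambda^{p,q}_m(F)$ whose pullback to the boundary of $F$ vanishes, i.e. $\operatorname{tr}^F_K\phi=0$ for all proper faces $K$ of $F$. Let $$\mathcal P_r\Lambda^{p,q}_m(\mathcal T)=\Bigl\{(\phi_F)_{F\in\mathfrak T}\in\prod_{F\in\mathfrak T}\mathcal P_r\Lambda^{p,q}_m(F)\Bigm|\operatorname{tr}^F_K\phi_F=\phi_K\text{ for all }K\le F\Bigr\},$$ let $\operatorname{tr}^{\mathcal T}_F\colon\mathcal P_r\Lambda^{p,q}_m(\mathcal T)\to\mathcal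 P_r\Lambda^{p,q}_m(F)$ be the projection, and let $(\operatorname{tr}^{\mathcal T}_F)^*\colon\mathcal P_r\Lambda^{p,q}_m(F)^*\to\mathcal P_r\Lambda^{p,q}_m(\mathcal T)^*$ be its dual map. Finally let $\mathring{\mathcal P}_r\Lambda^{p,q}_m(F)^\dagger\subseteq\mathcal P_r\Lambda^{p,q}_m(F)^*$ be the set of all linear functionals $\langle\phi,\cdot\rangle$ with $\phi\in\mathring{\mathcal P}_r\Lambda^{p,q}_m(F)$, where $\langle\phi,\psi\rangle=\int_F\langle\phi_x,\psi_x\rangle\,dx$ is the $L^2$ inner product of double forms on $F$ (for $F$ a vertex, the inner product at that point). **Theorem.** Let $p,q,m,r\ge0$ be integers with $(r,m)\ne(0,q)$. Then $$\mathcal P_r\Lambda^{p,q}_m(\mathcal T)^*=\bigoplus_{F\in\mathfrak T}(\operatorname{tr}^{\mathcal T}_F)^*\,\mathring{\mathcal P}_r\Lambda^{p,q}_m(F)^\dagger ,$$ an internal direct sum of subspaces. -/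

import Mathlib

open MeasureTheory

noncomputable section

/-! ### Double multicovectors -/

/-- The space `Λ^{p,q} = ⋀^p W* ⊗ ⋀^q W*` of `(p,q)`-covectors on `W`, seen as the `(p+q)`-linear
functionals that alternate in the first `p` and in the last `q` arguments: `φ X Y` is
`φ(X₁, …, X_p; Y₁, …, Y_q)`. -/
abbrev DoubleCovector (p q : ℕ) (W : Type*) [AddCommGroup W] [Module ℝ W] : Type _ :=
  W [⋀^Fin p]→ₗ[ℝ] (W [⋀^Fin q]→ₗ[ℝ] ℝ)

namespace DoubleCovector

variable {W W' : Type*} [AddCommGroup W] [Module ℝ W] [AddCommGroup W'] [Module ℝ W']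

/-- `moveLeft φ x X Y = φ(X; x, Y)`, linear in `x`. -/
def moveLeft {p q : ℕ} (φ : DoubleCovector p (q + 1) W) : W →ₗ[ℝ] DoubleCovector p q W where
  toFun x := (AlternatingMap.curryLeftLinearMap.flip x).compAlternatingMap φ
  map_add' x y := by ext X Y; simp
  map_smul' c x := by ext X Y; simp

/-- `moveRight φ X x Y = φ(x, X; Y)`, alternating in `X` and linear in `x`. -/
def moveRight {p q : ℕ} (φ : DoubleCovector (p + 1) q W) :
    W [⋀^Fin p]→ₗ[ℝ] (W →ₗ[ℝ] W [⋀^Fin q]→ₗ[ℝ] ℝ) where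
  toFun X :=
    { toFun := fun x => φ.curryLeft x X
      map_add' := fun x y => by simp
      map_smul' := fun c x => by simp }
  map_update_add' X i a b := by
    ext x Y
    exact congrArg (fun f => f Y) ((φ.curryLeft x).map_update_add X i a b)
  map_update_smul' X i c a := by
    ext x Y
    exact congrArg (fun f => f Y) ((φ.curryLeft x).map_update_smul X i c a)
  map_eq_zero_of_eq' X i j h hij := by
    ext x Y
    exact congrArg (fun f => f Y) ((φ.curryLeft x).map_eq_zero_of_eq X h hij)

/-- The Bianchi sum `s : Λ^{p,q+1} → Λ^{p+1,q}`. -/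
def bianchi (p q : ℕ) : DoubleCovector p (q + 1) W →ₗ[ℝ] DoubleCovector (p + 1) q W where
  toFun φ := AlternatingMap.alternatizeUncurryFin (moveLeft φ)
  map_add' φ ψ := by
    rw [← AlternatingMap.alternatizeUncurryFin_add]
    congr 1
  map_smul' c φ := by
    rw [RingHom.id_apply, ← AlternatingMap.alternatizeUncurryFin_smul]
    congr 1

theorem bianchi_apply {p q : ℕ} (φ : DoubleCovector p (q + 1) W) (X : Fin (p + 1) → W)
    (Y : Fin q → W) :
    bianchi p q φ X Y =
      ∑ a : Fin (p + 1), (-1 : ℝ) ^ (a : ℕ) * φ (a.removeNth X) (Fin.cons (X a) Y) := by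
  have hev : ∀ c : ℤ, ∀ ψ : W [⋀^Fin q]→ₗ[ℝ] ℝ, (c • ψ) Y = (c : ℝ) * ψ Y := fun c ψ => by
    rw [← zsmul_eq_mul]; rfl
  have hsum : ∀ f : Fin (p + 1) → W [⋀^Fin q]→ₗ[ℝ] ℝ, (∑ a, f a) Y = ∑ a, f a Y := fun f =>
    map_sum ({ toFun := fun ψ => ψ Y, map_zero' := rfl, map_add' := fun _ _ => rfl } :
      (W [⋀^Fin q]→ₗ[ℝ] ℝ) →+ ℝ) f _
  simp only [bianchi, LinearMap.coe_mk, AddHom.coe_mk, AlternatingMap.alternatizeUncurryFin_apply]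
  rw [hsum]
  refine Finset.sum_congr rfl fun a _ => ?_
  rw [hev]
  push_cast
  rfl

/-- The map `s* : Λ^{p+1,q} → Λ^{p,q+1}`. -/
def bianchiStar (p q : ℕ) : DoubleCovector (p + 1) q W →ₗ[ℝ] DoubleCovector p (q + 1) W where
  toFun φ := (AlternatingMap.alternatizeUncurryFinLM (R := ℝ) (M := W) (N := ℝ)
    (n := q)).compAlternatingMap (moveRight φ)
  map_add' φ ψ := by
    rw [← LinearMap.compAlternatingMap_add]
    congr 1
  map_smul' c φ := by
    rw [RingHom.id_apply, ← LinearMap.compAlternatingMap_smul]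
    congr 1

theorem bianchiStar_apply {p q : ℕ} (φ : DoubleCovector (p + 1) q W) (X : Fin p → W)
    (Y : Fin (q + 1) → W) :
    bianchiStar p q φ X Y =
      ∑ a : Fin (q + 1), (-1 : ℝ) ^ (a : ℕ) * φ (Fin.cons (Y a) X) (a.removeNth Y) := by
  simp only [bianchiStar, LinearMap.coe_mk, AddHom.coe_mk, LinearMap.compAlternatingMap_apply,
    AlternatingMap.alternatizeUncurryFinLM_apply, AlternatingMap.alternatizeUncurryFin_apply]
  refine Finset.sum_congr rfl fun a _ => ?_
  rw [zsmul_eq_mul]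
  push_cast
  rfl

/-- The endomorphism `s* s` of `Λ^{p,q}`; for `q = 0` it is zero, because `Λ^{p+1,-1} = 0`. -/
def bianchiStarBianchi (p : ℕ) : (q : ℕ) → Module.End ℝ (DoubleCovector p q W)
  | 0 => 0
  | q + 1 => bianchiStar p q ∘ₗ bianchi p q

/-- `Λ^{p,q}_m`: the eigenspace of `s* s` with eigenvalue `m (m + p - q + 1)`. -/
def summand (p q m : ℕ) (W : Type*) [AddCommGroup W] [Module ℝ W] :
    Submodule ℝ (DoubleCovector p q W) :=
  Module.End.eigenspace (R := ℝ) (M := DoubleCovector p q W) (bianchiStarBianchi p q)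
    ((m : ℝ) * ((m : ℝ) + (p : ℝ) - (q : ℝ) + 1))

/-- Pullback of double multicovectors along a linear map. -/
def pullback (p q : ℕ) (f : W →ₗ[ℝ] W') : DoubleCovector p q W' →ₗ[ℝ] DoubleCovector p q W where
  toFun φ :=
    LinearMap.compAlternatingMap
      ({ toFun := fun β => β.compLinearMap f
         map_add' := fun _ _ => rfl
         map_smul' := fun _ _ => rfl } : (W' [⋀^Fin q]→ₗ[ℝ] ℝ) →ₗ[ℝ] (W [⋀^Fin q]→ₗ[ℝ] ℝ))
      (φ.compLinearMap f)
  map_add' φ ψ := by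
    ext X Y
    rfl
  map_smul' c φ := by
    ext X Y
    rfl

theorem pullback_apply {p q : ℕ} (f : W →ₗ[ℝ] W') (φ : DoubleCovector p q W') (X : Fin p → W)
    (Y : Fin q → W) : pullback p q f φ X Y = φ (fun i => f (X i)) (fun j => f (Y j)) := rfl

/-- Every inner product on a finite-dimensional space has an orthonormal basis. -/
theorem exists_orthonormal [FiniteDimensional ℝ W] (g : InnerProductSpace.Core ℝ W) :
    ∃ b : Module.Basis (Fin (Module.finrank ℝ W)) ℝ W,
      ∀ i j, g.inner (b i) (b j) = if i = j then 1 else 0 := by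
  let _ : NormedAddCommGroup W := g.toNormedAddCommGroup
  let _ : InnerProductSpace ℝ W := InnerProductSpace.ofCore g.toCore
  refine ⟨(stdOrthonormalBasis ℝ W).toBasis, fun i j => ?_⟩
  have := orthonormal_iff_ite.mp (stdOrthonormalBasis ℝ W).orthonormal i j
  simpa using this

/-- An orthonormal basis `e₁, …, eₙ` of `W` for the inner product `g`. -/
def orthonormalBasis [FiniteDimensional ℝ W] (g : InnerProductSpace.Core ℝ W) :
    Module.Basis (Fin (Module.finrank ℝ W)) ℝ W :=
  (exists_orthonormal g).choose

/-- The inner product on `Λ^{p,q}` induced by an inner product on `W`: the one for which the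
`e^I ⊗ e^J`, with `I` and `J` increasing multi-indices, are orthonormal. The coefficient of `φ` at
`e^I ⊗ e^J` is `φ(e_{i₁}, …, e_{i_p}; e_{j₁}, …, e_{j_q})`. It does not depend on the orthonormal
basis. -/
def inner {p q : ℕ} [FiniteDimensional ℝ W] (g : InnerProductSpace.Core ℝ W)
    (φ ψ : DoubleCovector p q W) : ℝ :=
  ∑ I : Fin p ↪o Fin (Module.finrank ℝ W), ∑ J : Fin q ↪o Fin (Module.finrank ℝ W),
    φ (orthonormalBasis g ∘ I) (orthonormalBasis g ∘ J) *
      ψ (orthonormalBasis g ∘ I) (orthonormalBasis g ∘ J)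

end DoubleCovector

/-! ### Polynomial double forms on a simplex

For a finite type `ι` of vertices, the simplex is
`stdSimplex ℝ ι = {x : ι → ℝ | 0 ≤ x i, ∑ i, x i = 1}` (barycentric coordinates). -/

/-- The tangent space `{v | ∑ i, v i = 0}` of the simplex with vertex set `ι`. -/
def simplexTangent (ι : Type*) [Fintype ι] : Submodule ℝ (ι → ℝ) :=
  LinearMap.ker (∑ i, LinearMap.proj i : (ι → ℝ) →ₗ[ℝ] ℝ)

theorem mem_simplexTangent {ι : Type*} [Fintype ι] {v : ι → ℝ} :
    v ∈ simplexTangent ι ↔ ∑ i, v i = 0 := by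
  simp [simplexTangent]

/-- The derivative of the affine map `stdSimplex.map f` of simplices induced by a map `f` of
vertices: `(f_* v) k = ∑_{f i = k} v i`. For an inclusion `f` it is extension by zero. -/
def simplexTangentMap {ι κ : Type*} [Fintype ι] [Fintype κ] (f : ι → κ) :
    simplexTangent ι →ₗ[ℝ] simplexTangent κ :=
  (FunOnFinite.linearMap ℝ ℝ f).restrict fun v hv => by
    classical
    rw [mem_simplexTangent] at hv ⊢
    simp only [FunOnFinite.linearMap_apply_apply]
    exact (Finset.sum_fiberwise _ f v).trans hv

/-- Double forms of type `(p,q)` on the simplex with vertex set `ι` (no regularity imposed). -/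
abbrev DoubleForm (p q : ℕ) (ι : Type*) [Fintype ι] : Type _ :=
  stdSimplex ℝ ι → DoubleCovector p q (simplexTangent ι)

namespace DoubleForm

/-- `P_r Λ^{p,q}_m` of the simplex with vertex set `ι`: the double forms with polynomial
coefficients of degree at most `r` that lie pointwise in `Λ^{p,q}_m`. -/
def poly (r p q m : ℕ) (ι : Type*) [Fintype ι] : Submodule ℝ (DoubleForm p q ι) where
  carrier := {φ | (∀ X Y, ∃ P : MvPolynomial ι ℝ, P.totalDegree ≤ r ∧
      ∀ x : stdSimplex ℝ ι, φ x X Y = MvPolynomial.eval (x : ι → ℝ) P) ∧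
    ∀ x, φ x ∈ DoubleCovector.summand p q m (simplexTangent ι)}
  zero_mem' := ⟨fun X Y => ⟨0, by simp, by simp⟩, fun x => Submodule.zero_mem _⟩
  add_mem' := by
    rintro φ ψ ⟨h1, h2⟩ ⟨h3, h4⟩
    refine ⟨fun X Y => ?_, fun x => Submodule.add_mem _ (h2 x) (h4 x)⟩
    obtain ⟨P, hP, hP'⟩ := h1 X Y
    obtain ⟨Q, hQ, hQ'⟩ := h3 X Y
    exact ⟨P + Q, (MvPolynomial.totalDegree_add P Q).trans (max_le hP hQ),
      fun x => by simp [hP', hQ']⟩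
  smul_mem' := by
    rintro c φ ⟨h1, h2⟩
    refine ⟨fun X Y => ?_, fun x => Submodule.smul_mem _ c (h2 x)⟩
    obtain ⟨P, hP, hP'⟩ := h1 X Y
    exact ⟨c • P, (MvPolynomial.totalDegree_smul_le c P).trans hP, fun x => by
      simp [hP', MvPolynomial.smul_eval]⟩

/-- Pullback of double forms along the affine map of simplices induced by a map of vertices. -/
def pullback (p q : ℕ) {ι κ : Type*} [Fintype ι] [Fintype κ] (f : ι → κ) :
    DoubleForm p q κ →ₗ[ℝ] DoubleForm p q ι where
  toFun φ x := DoubleCovector.pullback p q (simplexTangentMap f) (φ (stdSimplex.map f x))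
  map_add' φ ψ := by ext x; simp
  map_smul' c φ := by ext x; simp

/-- The trace `tr^F_K`: pullback along the inclusion of the simplex `K` as a face of `F`. -/
def trace (p q : ℕ) {V : Type*} {K F : Finset V} (h : K ⊆ F) :
    DoubleForm p q F →ₗ[ℝ] DoubleForm p q K :=
  pullback p q (Set.inclusion (Finset.coe_subset.mpr h))

/-- The subspace `P̊_r Λ^{p,q}_m(F)` of `P_r Λ^{p,q}_m(F)`: forms with vanishing trace on the
boundary of `F`, which is the union of the proper faces of `F`. -/
def vanishingTrace (r p q m : ℕ) {V : Type*} (F : Finset V) :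
    Submodule ℝ (poly r p q m F) where
  carrier := {φ | ∀ (K : Finset V) (h : K ⊂ F), trace p q h.subset (φ : DoubleForm p q F) = 0}
  zero_mem' := fun K h => by simp
  add_mem' := fun h1 h2 K h => by simp [h1 K h, h2 K h]
  smul_mem' := fun c φ h1 K h => by simp [h1 K h]

variable {ι : Type*} [Fintype ι]

/-- The difference of a point of the simplex and its barycenter. -/
def fromBarycenter (x : stdSimplex ℝ ι) : simplexTangent ι :=
  ⟨fun i => x i - (Fintype.card ι : ℝ)⁻¹, by
    have hx : ∑ i, x i = 1 := x.2.2
    have : Nonempty ι := by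
      by_contra h
      rw [not_nonempty_iff] at h
      simp at hx
    rw [mem_simplexTangent, Finset.sum_sub_distrib, hx]
    simp⟩

/-- The Riemannian volume measure on the simplex for the constant metric `g`: Lebesgue measure of
the tangent space, normalized so that the unit cube on a `g`-orthonormal basis has measure one,
transported to the simplex by translation. On a point it is the unit mass. -/
def simplexVolume (g : InnerProductSpace.Core ℝ (simplexTangent ι)) : Measure (stdSimplex ℝ ι) :=
  (DoubleCovector.orthonormalBasis g).addHaar.comap fromBarycenter

/-- The `L²` inner product `⟨φ, ψ⟩ = ∫_F ⟨φ_x, ψ_x⟩ dx` of double forms. -/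
def l2Inner {p q : ℕ} (g : InnerProductSpace.Core ℝ (simplexTangent ι)) (φ ψ : DoubleForm p q ι) :
    ℝ :=
  ∫ x, DoubleCovector.inner g (φ x) (ψ x) ∂(simplexVolume g)

theorem isClosedEmbedding_fromBarycenter :
    Topology.IsClosedEmbedding (fromBarycenter : stdSimplex ℝ ι → simplexTangent ι) := by
  refine Continuous.isClosedEmbedding ?_ ?_
  · refine Continuous.subtype_mk (continuous_pi fun i => ?_) _
    exact ((continuous_apply i).comp continuous_subtype_val).sub continuous_const
  · intro x y h
    ext i
    have := congrFun (congrArg Subtype.val h) i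
    simpa [fromBarycenter] using this

instance (g : InnerProductSpace.Core ℝ (simplexTangent ι)) : IsFiniteMeasure (simplexVolume g) := by
  constructor
  have he := isClosedEmbedding_fromBarycenter (ι := ι)
  rw [simplexVolume, he.measurableEmbedding.comap_apply, Set.image_univ]
  exact (isCompact_range he.continuous).measure_lt_top

theorem continuous_coeff {r p q m : ℕ} {φ : DoubleForm p q ι} (h : φ ∈ poly r p q m ι)
    (X : Fin p → simplexTangent ι) (Y : Fin q → simplexTangent ι) :
    Continuous fun x => φ x X Y := by
  obtain ⟨P, -, hP⟩ := h.1 X Y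
  simp only [hP]
  exact (MvPolynomial.continuous_eval P).comp continuous_subtype_val

theorem integrable_inner {r p q m : ℕ} (g : InnerProductSpace.Core ℝ (simplexTangent ι))
    {φ ψ : DoubleForm p q ι} (hφ : φ ∈ poly r p q m ι) (hψ : ψ ∈ poly r p q m ι) :
    Integrable (fun x => DoubleCovector.inner g (φ x) (ψ x)) (simplexVolume g) := by
  have hc : Continuous fun x => DoubleCovector.inner g (φ x) (ψ x) :=
    continuous_finsetSum _ fun I _ => continuous_finsetSum _ fun J _ =>
      (continuous_coeff hφ _ _).mul (continuous_coeff hψ _ _)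
  exact hc.integrable_of_hasCompactSupport (HasCompactSupport.of_compactSpace _)

/-- The linear map `φ ↦ ⟨φ, ·⟩` from `P_r Λ^{p,q}_m` to its dual. -/
def l2Functional (r p q m : ℕ) (g : InnerProductSpace.Core ℝ (simplexTangent ι)) :
    poly r p q m ι →ₗ[ℝ] Module.Dual ℝ (poly r p q m ι) :=
  LinearMap.mk₂ ℝ (fun φ ψ => l2Inner g (φ : DoubleForm p q ι) (ψ : DoubleForm p q ι))
    (fun φ φ' ψ => by
      rw [l2Inner, l2Inner, l2Inner, ← integral_add (integrable_inner g φ.2 ψ.2)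
        (integrable_inner g φ'.2 ψ.2)]
      simp [DoubleCovector.inner, add_mul, Finset.sum_add_distrib])
    (fun c φ ψ => by
      rw [l2Inner, l2Inner, smul_eq_mul, ← integral_const_mul]
      simp [DoubleCovector.inner, mul_assoc, Finset.mul_sum])
    (fun φ ψ ψ' => by
      rw [l2Inner, l2Inner, l2Inner, ← integral_add (integrable_inner g φ.2 ψ.2)
        (integrable_inner g φ.2 ψ'.2)]
      simp [DoubleCovector.inner, mul_add, Finset.sum_add_distrib])
    (fun c φ ψ => by
      rw [l2Inner, l2Inner, smul_eq_mul, ← integral_const_mul]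
      simp [DoubleCovector.inner, mul_left_comm, Finset.mul_sum])

/-- `P̊_r Λ^{p,q}_m(F)^†`: the functionals `⟨φ, ·⟩` on `P_r Λ^{p,q}_m(F)` with
`φ ∈ P̊_r Λ^{p,q}_m(F)`. -/
def dagger (r p q m : ℕ) {V : Type*} (F : Finset V)
    (g : InnerProductSpace.Core ℝ (simplexTangent F)) :
    Submodule ℝ (Module.Dual ℝ (poly r p q m F)) :=
  (vanishingTrace r p q m F).map (l2Functional r p q m g)

end DoubleForm

/-! ### The finite element space of a triangulation -/

/-- `P_r Λ^{p,q}_m(𝒯)`: families `(φ_F)` of forms `φ_F ∈ P_r Λ^{p,q}_m(F)`, indexed by the simplices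
of `𝒯`, with `tr^F_K φ_F = φ_K` for all simplices `K ≤ F` of `𝒯`. -/
def globalSpace (r p q m : ℕ) {V : Type*} (T : PreAbstractSimplicialComplex V) :
    Submodule ℝ (∀ F : T, DoubleForm.poly r p q m (F : Finset V)) where
  carrier := {φ | ∀ (K F : T) (h : (K : Finset V) ⊆ (F : Finset V)),
    DoubleForm.trace p q h (φ F : DoubleForm p q (F : Finset V)) = φ K}
  zero_mem' := fun K F h => by simp
  add_mem' := fun h1 h2 K F h => by simp [h1 K F h, h2 K F h]
  smul_mem' := fun c φ h1 K F h => by simp [h1 K F h]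

/-- The trace `tr^𝒯_F : P_r Λ^{p,q}_m(𝒯) → P_r Λ^{p,q}_m(F)`, `(φ_K)_K ↦ φ_F`. -/
def globalTrace (r p q m : ℕ) {V : Type*} (T : PreAbstractSimplicialComplex V) (F : T) :
    globalSpace r p q m T →ₗ[ℝ] DoubleForm.poly r p q m (F : Finset V) :=
  LinearMap.proj F ∘ₗ (globalSpace r p q m T).subtype

end

/-! Everything rests on an extension property: a form on a simplex K with vanishing boundary trace
extends to a family on all simplices, compatible with traces, that vanishes on every simplex not
containing K. Evaluating the functionals on such extensions is then triangular with respect to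
inclusion of simplices, with definite L² inner products on the diagonal, and
`isInternal_dual_of_extension` turns this into the direct sum.

Extensions to F are built by pulling covectors of K back along affine maps F → K given on vertices,
and multiplying by barycentric monomials extended by zero. Such pullbacks commute with s*s, hence
preserve the eigenspaces. If F does not contain K and the vertices of F go into K ∩ F, the pullback
factors through a proper face of K, where the trace vanishes.

For r > 0, write the form as ∑ x^α ω_α with |α| = r and send the vertices outside K to a vertex j
with α_j ≠ 0. If F does not contain K, either x^α vanishes on F, or its support, hence j, lies in F;
in the latter case linear independence of monomials on K ∩ F kills the pullback of ω_α.

For r = 0 no monomial singles out a vertex. Instead, sum over pairs i, j the alternating combination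
of the four maps: swap i and j, i ↦ j, j ↦ i, identity. If i or j is missing from F, these agree in
pairs on F and cancel; otherwise each factors through K ∩ F. On K they are shears along e_i - e_j,
so the combination is a mixed second difference, and the total is 2(pq + q - s*s), which is the
scalar 2(q - m)(p + 1 + m) on the eigenspace (`sum_pullback_vertices`). It is nonzero because m ≠ q.
-/

noncomputable section

/-! ### Alternating maps -/

namespace AlternatingMap

variable {R M N : Type*} [CommRing R] [AddCommGroup M] [Module R M] [AddCommGroup N] [Module R N]

/-- Adding multiples of one vector to all arguments of an alternating map. -/
theorem map_add_smul_const {ι : Type*} [Fintype ι] [DecidableEq ι] (f : M [⋀^ι]→ₗ[R] N)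
    (v : ι → M) (c : ι → R) (u : M) :
    f (fun a => v a + c a • u) = f v + ∑ a, c a • f (Function.update v a u) := by
  have key : ∀ s : Finset ι, f (fun a => v a + if a ∈ s then c a • u else 0) =
      f v + ∑ a ∈ s, c a • f (Function.update v a u) := by
    intro s
    induction s using Finset.induction_on with
    | empty => simp
    | insert b s hb ih =>
      have h1 : (fun a => v a + if a ∈ insert b s then c a • u else 0) =
          Function.update (fun a => v a + if a ∈ s then c a • u else 0) b (v b + c b • u) := by
        funext a
        by_cases hab : a = b
        · subst hab; simp
        · simp [hab]
      have h2 : Function.update (fun a => v a + if a ∈ s then c a • u else 0) b (v b) =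
          fun a => v a + if a ∈ s then c a • u else 0 := by
        rw [Function.update_eq_self_iff]; simp [hb]
      -- Once `u` occupies place `b`, multiples of `u` added elsewhere contribute nothing, by
      -- alternation.
      have h3 : ∀ t : Finset ι, b ∉ t →
          f (Function.update (fun a => v a + if a ∈ t then c a • u else 0) b u) =
            f (Function.update v b u) := by
        intro t
        induction t using Finset.induction_on with
        | empty => simp
        | insert d t hd iht =>
          intro hbt
          simp only [Finset.mem_insert, not_or] at hbt
          rw [← iht hbt.2]
          have h4 : Function.update (fun a => v a + if a ∈ insert d t then c a • u else 0) b u =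
              Function.update (Function.update
                (fun a => v a + if a ∈ t then c a • u else 0) b u) d (v d + c d • u) := by
            funext a
            by_cases had : a = d
            · subst had; simp [Ne.symm hbt.1]
            · by_cases hab : a = b
              · subst hab; simp [had]
              · simp [had, hab]
          rw [h4, f.map_update_add, f.map_update_smul]
          have h5 : Function.update (Function.update
              (fun a => v a + if a ∈ t then c a • u else 0) b u) d (v d) =
              Function.update (fun a => v a + if a ∈ t then c a • u else 0) b u := by
            rw [Function.update_eq_self_iff, Function.update_of_ne (Ne.symm hbt.1)]
            simp [hd]
          rw [h5, f.map_eq_zero_of_eq (Function.update (Function.update _ b u) d u) (i := b)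
            (j := d) (by simp [hbt.1]) hbt.1]
          simp
      rw [h1, f.map_update_add, f.map_update_smul, h2, ih, h3 s hb, Finset.sum_insert hb]
      abel
  simpa using key Finset.univ

/-- Moving a new first argument into the place of an omitted one. -/
theorem neg_one_pow_smul_map_cons_removeNth {n : ℕ} (f : M [⋀^Fin (n + 1)]→ₗ[R] N)
    (i : Fin (n + 1)) (x : M) (v : Fin (n + 1) → M) :
    (-1 : ℤ) ^ (i : ℕ) • f (Fin.cons x (i.removeNth v)) = f (Function.update v i x) := by
  rw [← Fin.insertNth_removeNth, map_insertNth]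
  rfl

theorem finiteDimensional {K V V' ι : Type*} [Field K] [AddCommGroup V] [Module K V]
    [FiniteDimensional K V] [AddCommGroup V'] [Module K V'] [FiniteDimensional K V'] [Finite ι] :
    FiniteDimensional K (V [⋀^ι]→ₗ[K] V') :=
  FiniteDimensional.of_injective
    (toMultilinearMapLM : V [⋀^ι]→ₗ[K] V' →ₗ[K] MultilinearMap K (fun _ : ι => V) V')
    coe_multilinearMap_injective

end AlternatingMap

/-! ### The operator s*s and pullbacks along shears -/

namespace DoubleCovector

variable {W W' W'' : Type*} [AddCommGroup W] [Module ℝ W] [AddCommGroup W'] [Module ℝ W']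
  [AddCommGroup W''] [Module ℝ W'']

/-- Evaluation of double multicovectors at given arguments. -/
def evalAt {p q : ℕ} (X : Fin p → W) (Y : Fin q → W) : DoubleCovector p q W →ₗ[ℝ] ℝ where
  toFun φ := φ X Y
  map_add' _ _ := rfl
  map_smul' _ _ := rfl

theorem evalAt_apply {p q : ℕ} (X : Fin p → W) (Y : Fin q → W) (φ : DoubleCovector p q W) :
    evalAt X Y φ = φ X Y := rfl

theorem sum_apply_apply {p q : ℕ} {κ : Type*} (s : Finset κ) (φ : κ → DoubleCovector p q W)
    (X : Fin p → W) (Y : Fin q → W) : (∑ k ∈ s, φ k) X Y = ∑ k ∈ s, φ k X Y :=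
  map_sum (evalAt X Y) φ s

instance {p q : ℕ} [FiniteDimensional ℝ W] : FiniteDimensional ℝ (DoubleCovector p q W) := by
  have : FiniteDimensional ℝ (W [⋀^Fin q]→ₗ[ℝ] ℝ) := AlternatingMap.finiteDimensional
  exact AlternatingMap.finiteDimensional

theorem pullback_comp {p q : ℕ} (f : W →ₗ[ℝ] W') (f' : W' →ₗ[ℝ] W'') (φ : DoubleCovector p q W'') :
    pullback p q (f' ∘ₗ f) φ = pullback p q f (pullback p q f' φ) := rfl

/-- `s* s` in terms of exchanges of one argument of each group. -/
theorem bianchiStarBianchi_apply {p q : ℕ} (φ : DoubleCovector p q W) (X : Fin p → W)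
    (Y : Fin q → W) :
    bianchiStarBianchi p q φ X Y = q * φ X Y -
      ∑ a, ∑ b, φ (Function.update X a (Y b)) (Function.update Y b (X a)) := by
  cases q with
  | zero => simp [bianchiStarBianchi]
  | succ q =>
    have hsign : ∀ (b : Fin (q + 1)) (Z : Fin p → W) (w : W),
        (-1 : ℝ) ^ (b : ℕ) * φ Z (Fin.cons w (b.removeNth Y)) =
          φ Z (Function.update Y b w) := fun b Z w => by
      rw [← AlternatingMap.neg_one_pow_smul_map_cons_removeNth, zsmul_eq_mul]
      push_cast
      rfl
    -- The zeroth term of the Bianchi sum puts `Y b` back in its place; each later one exchanges it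
    -- with some `X a`, the index shift giving the minus sign.
    have hterm : ∀ b : Fin (q + 1), (-1 : ℝ) ^ (b : ℕ) *
        bianchi p q φ (Fin.cons (Y b) X) (b.removeNth Y) =
        φ X Y - ∑ a, φ (Function.update X a (Y b)) (Function.update Y b (X a)) := by
      intro b
      rw [bianchi_apply, Fin.sum_univ_succ, mul_add, sub_eq_add_neg]
      congr 1
      · simp [hsign]
      · rw [Finset.mul_sum, ← Finset.sum_neg_distrib]
        refine Finset.sum_congr rfl fun a _ => ?_
        cases p with
        | zero => exact a.elim0
        | succ p =>
          have h1 : a.succ.removeNth (Fin.cons (Y b) X : Fin (p + 2) → W) =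
              Fin.cons (Y b) (a.removeNth X) := by
            funext i
            refine Fin.cases ?_ (fun i => ?_) i <;> simp [Fin.removeNth]
          have h2 : φ (Function.update X a (Y b)) =
              (-1 : ℤ) ^ (a : ℕ) • φ (Fin.cons (Y b) (a.removeNth X)) :=
            (AlternatingMap.neg_one_pow_smul_map_cons_removeNth φ a (Y b) X).symm
          have h3 : φ (Function.update X a (Y b)) (Function.update Y b (X a)) =
              (-1 : ℝ) ^ (a : ℕ) *
                φ (Fin.cons (Y b) (a.removeNth X)) (Function.update Y b (X a)) := by
            rw [h2]
            change (-1 : ℤ) ^ (a : ℕ) • (_ : ℝ) = _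
            rw [zsmul_eq_mul]
            push_cast
            rfl
          rw [h3, h1, ← hsign, Fin.val_succ, Fin.cons_succ, pow_succ]
          ring
    change bianchiStar p q (bianchi p q φ) X Y = _
    rw [bianchiStar_apply, Finset.sum_congr rfl fun b _ => hterm b, Finset.sum_sub_distrib,
      Finset.sum_comm]
    simp

/-- The exchange formula only permutes arguments, so it is natural for every linear map, injective
or not. -/
theorem bianchiStarBianchi_pullback {p q : ℕ} (f : W →ₗ[ℝ] W') (φ : DoubleCovector p q W') :
    bianchiStarBianchi p q (pullback p q f φ) = pullback p q f (bianchiStarBianchi p q φ) := by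
  ext X Y
  have h : ∀ {n : ℕ} (Z : Fin n → W) (a : Fin n) (w : W),
      (fun i => f (Function.update Z a w i)) = Function.update (fun i => f (Z i)) a (f w) :=
    fun Z a w => funext fun i => Function.apply_update (fun _ => f) Z a w i
  simp only [bianchiStarBianchi_apply, pullback_apply, h]

theorem mem_summand_iff {p q m : ℕ} {φ : DoubleCovector p q W} :
    φ ∈ summand p q m W ↔
      bianchiStarBianchi p q φ = ((m : ℝ) * ((m : ℝ) + (p : ℝ) - (q : ℝ) + 1)) • φ :=
  Module.End.mem_eigenspace_iff

theorem pullback_mem_summand {p q m : ℕ} (f : W →ₗ[ℝ] W') {φ : DoubleCovector p q W'}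
    (hφ : φ ∈ summand p q m W') : pullback p q f φ ∈ summand p q m W := by
  rw [mem_summand_iff] at hφ ⊢
  rw [bianchiStarBianchi_pullback, hφ, map_smul]

/-- Pullback along the map `x ↦ x + c(x) u`. -/
theorem pullback_shear_apply {p q : ℕ} (c : W →ₗ[ℝ] ℝ) (u : W) (φ : DoubleCovector p q W)
    (X : Fin p → W) (Y : Fin q → W) :
    pullback p q (LinearMap.id + c.smulRight u) φ X Y = φ X Y +
      ∑ a, c (X a) * φ (Function.update X a u) Y + ∑ b, c (Y b) * φ X (Function.update Y b u) +
      ∑ a, ∑ b, c (X a) * c (Y b) * φ (Function.update X a u) (Function.update Y b u) := by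
  have hX : φ (fun a => X a + c (X a) • u) =
      φ X + ∑ a, c (X a) • φ (Function.update X a u) :=
    φ.map_add_smul_const X (fun a => c (X a)) u
  have hY : ∀ ψ : W [⋀^Fin q]→ₗ[ℝ] ℝ, ψ (fun b => Y b + c (Y b) • u) =
      ψ Y + ∑ b, c (Y b) * ψ (Function.update Y b u) := fun ψ =>
    ψ.map_add_smul_const Y (fun b => c (Y b)) u
  have hs : ∀ Z : Fin q → W, (∑ a, c (X a) • φ (Function.update X a u)) Z =
      ∑ a, c (X a) * φ (Function.update X a u) Z := fun Z =>
    map_sum ({ toFun := fun ψ => ψ Z, map_zero' := rfl, map_add' := fun _ _ => rfl } :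
      (W [⋀^Fin q]→ₗ[ℝ] ℝ) →+ ℝ) (fun a => c (X a) • φ (Function.update X a u)) _
  change φ (fun a => X a + c (X a) • u) (fun b => Y b + c (Y b) • u) = _
  rw [hX, AlternatingMap.add_apply, hs]
  simp only [hY, mul_add, Finset.sum_add_distrib, Finset.mul_sum, mul_assoc]
  ring

/-- A mixed second difference of pullbacks along shears in the direction `u`. -/
theorem shear_difference_apply {p q : ℕ} (c d : W →ₗ[ℝ] ℝ) (u : W) (φ : DoubleCovector p q W)
    (X : Fin p → W) (Y : Fin q → W) :
    pullback p q (LinearMap.id + (d - c).smulRight u) φ X Y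
      - pullback p q (LinearMap.id + (-c).smulRight u) φ X Y
      - pullback p q (LinearMap.id + d.smulRight u) φ X Y + φ X Y =
    -∑ a, ∑ b, (c (X a) * d (Y b) + d (X a) * c (Y b)) *
      φ (Function.update X a u) (Function.update Y b u) := by
  -- The terms of degree 0 and 1 in the covector of the shear cancel; the quadratic one leaves its
  -- polarization.
  simp only [pullback_shear_apply, LinearMap.sub_apply, LinearMap.neg_apply, sub_mul, mul_sub, neg_mul, mul_neg,
    neg_neg, add_mul, Finset.sum_sub_distrib, Finset.sum_neg_distrib, Finset.sum_add_distrib]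
  ring

end DoubleCovector

/-! ### Vertex maps and edge vectors of a simplex -/

section SimplexTangent

variable {ι κ μ : Type*} [Fintype ι] [Fintype κ] [Fintype μ]

theorem simplexTangentMap_coe (f : ι → κ) (v : simplexTangent ι) :
    (simplexTangentMap f v : κ → ℝ) = FunOnFinite.linearMap ℝ ℝ f v := rfl

theorem simplexTangentMap_comp (f : ι → κ) (g : κ → μ) :
    simplexTangentMap (g ∘ f) = simplexTangentMap g ∘ₗ simplexTangentMap f := by
  refine LinearMap.ext fun v => Subtype.ext ?_
  rw [simplexTangentMap_coe, FunOnFinite.linearMap_comp]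
  rfl

theorem simplexTangentMap_id : simplexTangentMap (id : ι → ι) = LinearMap.id := by
  refine LinearMap.ext fun v => Subtype.ext ?_
  rw [simplexTangentMap_coe, FunOnFinite.linearMap_id]
  rfl

/-- The differential of a barycentric coordinate. -/
def simplexCoord (i : ι) : simplexTangent ι →ₗ[ℝ] ℝ :=
  LinearMap.proj i ∘ₗ (simplexTangent ι).subtype

theorem simplexCoord_apply (i : ι) (v : simplexTangent ι) : simplexCoord i v = (v : ι → ℝ) i := rfl

theorem sum_simplexCoord (v : simplexTangent ι) : ∑ i, simplexCoord i v = 0 :=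
  mem_simplexTangent.mp v.2

variable [DecidableEq ι]

/-- The edge vector `e_i - e_j` of a simplex. -/
def vertexDifference (i j : ι) : simplexTangent ι :=
  ⟨Pi.single i 1 - Pi.single j 1, by simp [mem_simplexTangent]⟩

/-- A vertex map that moves vertices by multiples of `e_i - e_j` induces a shear. -/
theorem simplexTangentMap_eq_shear {f : ι → ι} {i j : ι} (c : ι → ℝ)
    {d : simplexTangent ι →ₗ[ℝ] ℝ} (hd : ∀ v, d v = ∑ k, simplexCoord k v * c k)
    (h : ∀ k, (Pi.single (f k) 1 : ι → ℝ) =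
      Pi.single k 1 + c k • (Pi.single i 1 - Pi.single j 1)) :
    simplexTangentMap f = LinearMap.id + d.smulRight (vertexDifference i j) := by
  refine LinearMap.ext fun v => Subtype.ext ?_
  have hv : (v : ι → ℝ) = ∑ k, simplexCoord k v • Pi.single k 1 := by
    funext l
    simp [Finset.sum_apply, Pi.single_apply, simplexCoord_apply]
  have hsum : (simplexTangentMap f v : ι → ℝ) =
      (v : ι → ℝ) + d v • (Pi.single i 1 - Pi.single j 1) := by
    rw [simplexTangentMap_coe, hv, map_sum, hd, Finset.sum_smul, ← Finset.sum_add_distrib]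
    refine Finset.sum_congr rfl fun k _ => ?_
    rw [map_smul, FunOnFinite.linearMap_piSingle, h k, smul_add, smul_smul]
  exact hsum

theorem simplexTangentMap_swap (i j : ι) :
    simplexTangentMap (Equiv.swap i j) = LinearMap.id +
      (simplexCoord j - simplexCoord i).smulRight (vertexDifference i j) := by
  refine simplexTangentMap_eq_shear (Pi.single j 1 - Pi.single i 1)
    (fun v => by simp [mul_sub, Pi.single_apply]) fun k => ?_
  by_cases hi : k = i
  · subst hi
    by_cases hj : k = j
    · subst hj; simp
    · simp [hj]
  · by_cases hj : k = j
    · subst hj; simp [hi]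
    · simp [Equiv.swap_apply_of_ne_of_ne hi hj, hi, hj]

theorem simplexTangentMap_update_left (i j : ι) :
    simplexTangentMap (Function.update id i j) = LinearMap.id +
      (-simplexCoord i).smulRight (vertexDifference i j) := by
  refine simplexTangentMap_eq_shear (-Pi.single i 1)
    (fun v => by simp [Pi.single_apply]) fun k => ?_
  by_cases hi : k = i
  · subst hi; simp
  · simp [hi]

theorem simplexTangentMap_update_right (i j : ι) :
    simplexTangentMap (Function.update id j i) = LinearMap.id +
      (simplexCoord j).smulRight (vertexDifference i j) := by
  refine simplexTangentMap_eq_shear (Pi.single j 1)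
    (fun v => by simp [Pi.single_apply]) fun k => ?_
  by_cases hj : k = j
  · subst hj; simp
  · simp [hj]

/-- The base vertex `o` is arbitrary because the coordinates of a tangent vector sum to zero. -/
theorem sum_simplexCoord_smul_vertexDifference (v : simplexTangent ι) (o : ι) :
    ∑ i, simplexCoord i v • vertexDifference i o = v := by
  have h : ∑ i, simplexCoord i v • (vertexDifference i o : ι → ℝ) = v := by
    simp only [vertexDifference, smul_sub, Finset.sum_sub_distrib, ← Finset.sum_smul,
      sum_simplexCoord, zero_smul, sub_zero]
    funext k
    simp [Finset.sum_apply, Pi.single_apply, simplexCoord_apply]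
  refine Subtype.ext ?_
  rw [← h]
  simp

/-- A bilinear form on the tangent space, recovered from its values on the edges. -/
theorem sum_vertexDifference (β : simplexTangent ι →ₗ[ℝ] simplexTangent ι →ₗ[ℝ] ℝ)
    (x y : simplexTangent ι) :
    ∑ i, ∑ j, simplexCoord i x * simplexCoord j y *
      β (vertexDifference i j) (vertexDifference i j) = -(β x y + β y x) := by
  cases isEmpty_or_nonempty ι with
  | inl h =>
    have h0 : ∀ v : simplexTangent ι, v = 0 := fun v => Subtype.ext (Subsingleton.elim _ _)
    rw [h0 x]
    simp
  | inr h =>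
    obtain ⟨o⟩ := h
    have hd : ∀ i j : ι, vertexDifference i j = vertexDifference i o - vertexDifference j o :=
      fun i j => Subtype.ext (by simp [vertexDifference])
    have hxy : ∀ v w : simplexTangent ι, β v w = ∑ i, ∑ j, simplexCoord i v * simplexCoord j w *
        β (vertexDifference i o) (vertexDifference j o) := fun v w => by
      conv_lhs => rw [← sum_simplexCoord_smul_vertexDifference v o,
        ← sum_simplexCoord_smul_vertexDifference w o]
      simp only [map_sum, map_smul, LinearMap.sum_apply, LinearMap.smul_apply, smul_eq_mul,
        Finset.mul_sum]
      rw [Finset.sum_comm]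
      refine Finset.sum_congr rfl fun i _ => Finset.sum_congr rfl fun j _ => by ring
    -- With e_i - e_j expanded from the base vertex, the two diagonal terms depend on only one index
    -- and are killed by the vanishing coordinate sum; the two cross terms give the result.
    have h1 : ∑ i, ∑ j, simplexCoord i x * simplexCoord j y *
        β (vertexDifference i o) (vertexDifference i o) = 0 := by
      refine Finset.sum_eq_zero fun i _ => ?_
      rw [← Finset.sum_mul, ← Finset.mul_sum, sum_simplexCoord]
      simp
    have h2 : ∑ i, ∑ j, simplexCoord i x * simplexCoord j y *
        β (vertexDifference j o) (vertexDifference j o) = 0 := by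
      rw [Finset.sum_comm]
      refine Finset.sum_eq_zero fun j _ => ?_
      rw [← Finset.sum_mul, ← Finset.sum_mul, sum_simplexCoord]
      simp
    have h3 : β y x = ∑ i, ∑ j, simplexCoord i x * simplexCoord j y *
        β (vertexDifference j o) (vertexDifference i o) := by
      rw [hxy, Finset.sum_comm]
      refine Finset.sum_congr rfl fun i _ => Finset.sum_congr rfl fun j _ => by ring
    rw [h3, hxy x y, ← zero_add (-_), ← h1, ← add_zero (_ + _), ← h2]
    simp only [← Finset.sum_add_distrib, ← Finset.sum_neg_distrib]
    refine Finset.sum_congr rfl fun i _ => Finset.sum_congr rfl fun j _ => ?_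
    rw [hd i j]
    simp only [map_sub, LinearMap.sub_apply]
    ring

end SimplexTangent

/-! ### The vertex-exchange identity -/

namespace DoubleCovector

/-- The bilinear form obtained by freeing one argument of each group. -/
def bilinAt {W : Type*} [AddCommGroup W] [Module ℝ W] {p q : ℕ} (φ : DoubleCovector p q W)
    (X : Fin p → W) (Y : Fin q → W) (a : Fin p) (b : Fin q) : W →ₗ[ℝ] W →ₗ[ℝ] ℝ :=
  LinearMap.mk₂ ℝ (fun u w => φ (Function.update X a u) (Function.update Y b w))
    (fun u u' w => by rw [AlternatingMap.map_update_add]; rfl)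
    (fun c u w => by rw [AlternatingMap.map_update_smul]; rfl)
    (fun u w w' => by rw [AlternatingMap.map_update_add])
    (fun c u w => by rw [AlternatingMap.map_update_smul])

variable {ι : Type*} [Fintype ι] [DecidableEq ι]

/-- The sum over all pairs of vertices `i`, `j` of the alternating sum of the pullbacks along the
vertex maps that exchange `i` and `j`, send `i` to `j`, send `j` to `i`, and fix every vertex, acts
on each eigenspace of `s* s` as a scalar. -/
theorem sum_pullback_vertices {p q m : ℕ} {φ : DoubleCovector p q (simplexTangent ι)}
    (hφ : φ ∈ summand p q m (simplexTangent ι)) :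
    ∑ i : ι, ∑ j : ι, (pullback p q (simplexTangentMap (Equiv.swap i j)) φ
      - pullback p q (simplexTangentMap (Function.update id i j)) φ
      - pullback p q (simplexTangentMap (Function.update id j i)) φ
      + pullback p q (simplexTangentMap id) φ) =
    (2 * ((q : ℝ) - m) * (p + 1 + m)) • φ := by
  ext X Y
  rw [sum_apply_apply, Finset.sum_congr rfl fun i _ => sum_apply_apply _ _ _ _]
  have hij : ∀ i j : ι, (pullback p q (simplexTangentMap (Equiv.swap i j)) φ
      - pullback p q (simplexTangentMap (Function.update id i j)) φ
      - pullback p q (simplexTangentMap (Function.update id j i)) φ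
      + pullback p q (simplexTangentMap id) φ) X Y = -∑ a, ∑ b,
        (simplexCoord i (X a) * simplexCoord j (Y b) * bilinAt φ X Y a b (vertexDifference i j)
            (vertexDifference i j) +
          simplexCoord j (X a) * simplexCoord i (Y b) * bilinAt φ X Y a b (vertexDifference j i)
            (vertexDifference j i)) := fun i j => by
    -- Reversing the edge does not change the quadratic value, so the second half of the
    -- polarization is the first with i and j exchanged.
    have hneg : ∀ a b, bilinAt φ X Y a b (vertexDifference j i) (vertexDifference j i) =
        bilinAt φ X Y a b (vertexDifference i j) (vertexDifference i j) := fun a b => by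
      have : vertexDifference j i = -vertexDifference i j :=
        Subtype.ext (by simp [vertexDifference])
      rw [this]
      simp
    rw [simplexTangentMap_swap, simplexTangentMap_update_left, simplexTangentMap_update_right,
      simplexTangentMap_id]
    refine (shear_difference_apply (simplexCoord i) (simplexCoord j) (vertexDifference i j)
      φ X Y).trans ?_
    congr 1
    refine Finset.sum_congr rfl fun a _ => Finset.sum_congr rfl fun b _ => ?_
    rw [hneg, ← add_mul]
    rfl
  have hsum : ∑ i : ι, ∑ j : ι, ∑ a, ∑ b, simplexCoord i (X a) * simplexCoord j (Y b) *
      bilinAt φ X Y a b (vertexDifference i j) (vertexDifference i j) =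
      ∑ a, ∑ b, -(φ X Y + φ (Function.update X a (Y b)) (Function.update Y b (X a))) := by
    calc _ = ∑ a, ∑ b, ∑ i : ι, ∑ j : ι, simplexCoord i (X a) * simplexCoord j (Y b) *
        bilinAt φ X Y a b (vertexDifference i j) (vertexDifference i j) := by
          simp_rw [Finset.sum_comm (s := (Finset.univ : Finset ι)) (t := Finset.univ (α := Fin p)),
            Finset.sum_comm (s := (Finset.univ : Finset ι)) (t := Finset.univ (α := Fin q))]
      _ = _ := by
          -- At (X a, Y b) the freed bilinear form returns φ(X; Y); at (Y b, X a) it returns the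
          -- exchanged value.
          refine Finset.sum_congr rfl fun a _ => Finset.sum_congr rfl fun b _ => ?_
          rw [sum_vertexDifference]
          simp [bilinAt]
  have hsum' : ∑ i : ι, ∑ j : ι, ∑ a, ∑ b, simplexCoord j (X a) * simplexCoord i (Y b) *
      bilinAt φ X Y a b (vertexDifference j i) (vertexDifference j i) =
      ∑ a, ∑ b, -(φ X Y + φ (Function.update X a (Y b)) (Function.update Y b (X a))) := by
    rw [Finset.sum_comm, hsum]
  have hs := congrArg (evalAt X Y) (mem_summand_iff.mp hφ)
  rw [map_smul, evalAt_apply, evalAt_apply, bianchiStarBianchi_apply, smul_eq_mul] at hs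
  simp only [hij, Finset.sum_neg_distrib, Finset.sum_add_distrib] at hsum hsum' ⊢
  rw [hsum, hsum', ← evalAt_apply X Y (_ • φ), map_smul, evalAt_apply, smul_eq_mul]
  simp only [Finset.sum_const, Finset.card_univ, Fintype.card_fin, nsmul_eq_mul]
  -- The exchanges sum to q - s*s, and pq + q - m(m + p - q + 1) = (q - m)(p + 1 + m).
  linear_combination (-2 : ℝ) * hs

end DoubleCovector

/-! ### Finite-dimensional duality -/

section VectorSpace

/-! Vector spaces are stated here over an additive commutative monoid, because on iterated spaces of
alternating maps the monoid and group structures are only definitionally equal. -/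

variable {K M : Type*} [Field K] [AddCommMonoid M] [Module K M]

/-- A subspace of the dual of a finite-dimensional space that separates points is everything. -/
theorem Submodule.eq_top_of_forall_dual_eq_zero [Module.Finite K M]
    (S : Submodule K (Module.Dual K M)) (h : ∀ v, (∀ f ∈ S, f v = 0) → v = 0) : S = ⊤ := by
  let _ : AddCommGroup M := Module.addCommMonoidToAddCommGroup K
  have h0 : S.dualCoannihilator = ⊥ := by
    rw [eq_bot_iff]
    intro v hv
    exact h v fun f hf => (Submodule.mem_dualCoannihilator v).mp hv f hf
  rw [← Subspace.dualCoannihilator_dualAnnihilator_eq (W := S), h0, Submodule.dualAnnihilator_bot]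

/-- Composing coordinates on `S` with a projection onto `S` makes them functionals on all of `M`.
This reduces forms with values in an eigenspace to scalar polynomials without leaving the
eigenspace. -/
theorem Submodule.exists_dual_expansion [Module.Finite K M] (S : Submodule K M) :
    ∃ (n : ℕ) (b : Fin n → S) (c : Fin n → Module.Dual K M),
      ∀ v ∈ S, v = ∑ k, c k v • (b k : M) := by
  let _ : AddCommGroup M := Module.addCommMonoidToAddCommGroup K
  obtain ⟨π, hπ⟩ := LinearMap.exists_leftInverse_of_injective S.subtype
    (LinearMap.ker_eq_bot.mpr S.injective_subtype)
  let b := Module.finBasis K S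
  refine ⟨_, b, fun k => b.coord k ∘ₗ π, fun v hv => ?_⟩
  have h1 : π v = ⟨v, hv⟩ := LinearMap.congr_fun hπ ⟨v, hv⟩
  have h2 := congrArg S.subtype (b.sum_repr ⟨v, hv⟩)
  simp only [map_sum, map_smul, Submodule.subtype_apply] at h2
  rw [← h2]
  simp [h1, h2]

theorem Submodule.finite_of_le_range {N : Type*} [AddCommMonoid N] [Module K N] [Module.Finite K N]
    (f : N →ₗ[K] M) {S : Submodule K M} (h : S ≤ LinearMap.range f) : Module.Finite K S := by
  let _ : AddCommGroup M := Module.addCommMonoidToAddCommGroup K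
  let _ : AddCommGroup N := Module.addCommMonoidToAddCommGroup K
  exact Submodule.finiteDimensional_of_le h

theorem Submodule.finite_of_finite [Module.Finite K M] (S : Submodule K M) : Module.Finite K S := by
  let _ : AddCommGroup M := Module.addCommMonoidToAddCommGroup K
  exact FiniteDimensional.finiteDimensional_submodule S

end VectorSpace

/-! ### Homogeneous representatives of polynomials -/

namespace MvPolynomial

/-- On the hyperplane `∑ i, x i = 1`, a polynomial of degree at most `r` is homogeneous of
degree `r`. -/
theorem exists_isHomogeneous_eval_eq {ι R : Type*} [Fintype ι] [CommRing R] {r : ℕ}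
    (P : MvPolynomial ι R) (hP : P.totalDegree ≤ r) :
    ∃ Q : MvPolynomial ι R, Q.IsHomogeneous r ∧
      ∀ x : ι → R, ∑ i, x i = 1 → eval x Q = eval x P := by
  -- Each component is raised to degree `r` by a power of ∑ X_i, which equals 1 on the hyperplane.
  refine ⟨∑ d ∈ Finset.range (r + 1), homogeneousComponent d P * (∑ i, X i) ^ (r - d),
    IsHomogeneous.sum _ _ _ fun d hd => ?_, fun x hx => ?_⟩
  · have h1 : (∑ i, X i : MvPolynomial ι R).IsHomogeneous 1 :=
      IsHomogeneous.sum _ _ _ fun i _ => isHomogeneous_X R i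
    have h2 := (homogeneousComponent_isHomogeneous d P).mul (h1.pow (r - d))
    have h3 : d + 1 * (r - d) = r := by
      have := Finset.mem_range.mp hd
      omega
    rwa [h3] at h2
  · rw [map_sum]
    simp only [map_mul, map_pow, map_sum, eval_X, hx, one_pow, mul_one]
    conv_rhs => rw [← sum_homogeneousComponent P, map_sum]
    symm
    refine Finset.sum_subset (Finset.range_mono (by omega)) fun d _ hd => ?_
    rw [homogeneousComponent_eq_zero, map_zero]
    simpa [Nat.lt_succ_iff] using hd

theorem IsHomogeneous.eval_eq_sum_finsuppAntidiag {ι R : Type*} [Fintype ι] [DecidableEq ι]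
    [CommRing R] {r : ℕ} {Q : MvPolynomial ι R} (hQ : Q.IsHomogeneous r) (x : ι → R) :
    eval x Q = ∑ α ∈ Finset.univ.finsuppAntidiag r, coeff α Q * ∏ i, x i ^ α i := by
  rw [eval_eq']
  refine Finset.sum_subset (fun α hα => ?_) fun α _ hα => ?_
  · have h := hQ (mem_support_iff.mp hα)
    rw [Finset.mem_finsuppAntidiag]
    refine ⟨?_, Finset.subset_univ _⟩
    rw [Finsupp.weight_apply, Finsupp.sum_fintype _ _ (by simp)] at h
    simpa using h
  · rw [notMem_support_iff.mp hα, zero_mul]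

end MvPolynomial

/-! ### Monomial expansion of polynomial double forms -/

namespace DoubleForm

variable {ι : Type*} [Fintype ι]

/-- Linear functionals of a polynomial double form are polynomials. -/
theorem exists_eval_eq_dual {r p q m : ℕ} {φ : DoubleForm p q ι} (hφ : φ ∈ poly r p q m ι)
    (f : Module.Dual ℝ (DoubleCovector p q (simplexTangent ι))) :
    ∃ P : MvPolynomial ι ℝ, P.totalDegree ≤ r ∧
      ∀ x : stdSimplex ℝ ι, f (φ x) = MvPolynomial.eval (x : ι → ℝ) P := by
  -- The functionals with polynomial values on φ form a subspace; it contains the evaluations, which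
  -- separate points.
  let S : Submodule ℝ (Module.Dual ℝ (DoubleCovector p q (simplexTangent ι))) :=
    { carrier := {f | ∃ P : MvPolynomial ι ℝ, P.totalDegree ≤ r ∧
        ∀ x : stdSimplex ℝ ι, f (φ x) = MvPolynomial.eval (x : ι → ℝ) P}
      zero_mem' := ⟨0, by simp, by simp⟩
      add_mem' := by
        rintro f g ⟨P, hP, hP'⟩ ⟨Q, hQ, hQ'⟩
        exact ⟨P + Q, (MvPolynomial.totalDegree_add P Q).trans (max_le hP hQ),
          fun x => by simp [hP', hQ']⟩
      smul_mem' := by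
        rintro c f ⟨P, hP, hP'⟩
        exact ⟨c • P, (MvPolynomial.totalDegree_smul_le c P).trans hP,
          fun x => by simp [hP', MvPolynomial.smul_eval]⟩ }
  have hS : S = ⊤ := Submodule.eq_top_of_forall_dual_eq_zero S fun v hv => by
    ext X Y
    exact hv (DoubleCovector.evalAt X Y) (hφ.1 X Y)
  exact (hS ▸ Submodule.mem_top : f ∈ S)

/-- A polynomial double form is a combination of monomials of degree `r` in the barycentric
coordinates, with coefficients in the fibre. -/
theorem exists_monomial_expansion [DecidableEq ι] {r p q m : ℕ} {φ : DoubleForm p q ι}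
    (hφ : φ ∈ poly r p q m ι) :
    ∃ ω : (ι →₀ ℕ) → DoubleCovector p q (simplexTangent ι),
      (∀ α, ω α ∈ DoubleCovector.summand p q m (simplexTangent ι)) ∧
      ∀ x, φ x = ∑ α ∈ Finset.univ.finsuppAntidiag r, (∏ i, x i ^ α i) • ω α := by
  obtain ⟨n, b, c, hbc⟩ :=
    (DoubleCovector.summand p q m (simplexTangent ι)).exists_dual_expansion
  have hQ : ∀ k, ∃ Q : MvPolynomial ι ℝ, Q.IsHomogeneous r ∧
      ∀ x : stdSimplex ℝ ι, c k (φ x) = MvPolynomial.eval (x : ι → ℝ) Q := fun k => by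
    obtain ⟨P, hP, hP'⟩ := exists_eval_eq_dual hφ (c k)
    obtain ⟨Q, hQ, hQ'⟩ := MvPolynomial.exists_isHomogeneous_eval_eq P hP
    exact ⟨Q, hQ, fun x => (hP' x).trans (hQ' x x.2.2).symm⟩
  choose Q hQh hQe using hQ
  refine ⟨fun α => ∑ k, (Q k).coeff α • (b k : DoubleCovector p q (simplexTangent ι)),
    fun α => Submodule.sum_mem _ fun k _ => Submodule.smul_mem _ _ (b k).2, fun x => ?_⟩
  rw [hbc (φ x) (hφ.2 x)]
  simp only [hQe, (hQh _).eval_eq_sum_finsuppAntidiag, Finset.sum_smul, Finset.smul_sum, smul_smul]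
  rw [Finset.sum_comm]
  refine Finset.sum_congr rfl fun α _ => Finset.sum_congr rfl fun k _ => ?_
  rw [mul_comm]

instance {r p q m : ℕ} : Module.Finite ℝ (poly r p q m ι) := by
  classical
  let A : Finset (ι →₀ ℕ) := Finset.univ.finsuppAntidiag r
  let L : (A → DoubleCovector p q (simplexTangent ι)) →ₗ[ℝ] DoubleForm p q ι :=
    { toFun := fun ω x => ∑ α : A, (∏ i, x i ^ (α : ι →₀ ℕ) i) • ω α
      map_add' := fun ω ω' => by
        funext x
        simp [Finset.sum_add_distrib]
      map_smul' := fun c ω => by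
        funext x
        simp [Finset.smul_sum, smul_comm c] }
  refine Submodule.finite_of_le_range L fun φ hφ => ?_
  obtain ⟨ω, -, hω⟩ := exists_monomial_expansion hφ
  refine ⟨fun α => ω α, funext fun x => ?_⟩
  rw [hω x]
  exact Finset.sum_coe_sort A fun α => (∏ i, x i ^ α i) • ω α

theorem smul_const_mem_poly {r p q m : ℕ} {f : stdSimplex ℝ ι → ℝ} {P : MvPolynomial ι ℝ}
    (hP : P.totalDegree ≤ r) (hf : ∀ x, f x = MvPolynomial.eval (x : ι → ℝ) P)
    {ω : DoubleCovector p q (simplexTangent ι)}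
    (hω : ω ∈ DoubleCovector.summand p q m (simplexTangent ι)) :
    (fun x => f x • ω) ∈ poly r p q m ι := by
  refine ⟨fun X Y => ⟨ω X Y • P, (MvPolynomial.totalDegree_smul_le _ P).trans hP, fun x => ?_⟩,
    fun x => Submodule.smul_mem _ _ hω⟩
  change f x * ω X Y = _
  rw [hf, MvPolynomial.smul_eval, mul_comm]

end DoubleForm

/-! ### Extension of forms with vanishing trace -/

namespace DoubleForm

variable {V : Type*} [DecidableEq V]

/-- The barycentric coordinate of the vertex `v` on the simplex `F`, zero if `v ∉ F`. -/
def faceCoord (F : Finset V) (x : stdSimplex ℝ F) (v : V) : ℝ :=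
  if h : v ∈ F then x ⟨v, h⟩ else 0

/-- The monomial with exponents `α` on the vertices of `K`, as a function on the simplex `F`. -/
def faceMonomial {K : Finset V} (α : K →₀ ℕ) (F : Finset V) (x : stdSimplex ℝ F) : ℝ :=
  ∏ k : K, faceCoord F x k ^ α k

theorem faceCoord_map {G F : Finset V} (h : G ⊆ F) (x : stdSimplex ℝ G) (v : V) :
    faceCoord F (stdSimplex.map (Set.inclusion (Finset.coe_subset.mpr h)) x) v =
      faceCoord G x v := by
  unfold faceCoord
  by_cases hF : v ∈ F
  · rw [dif_pos hF, stdSimplex.map_coe, FunOnFinite.linearMap_apply_apply]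
    by_cases hG : v ∈ G
    · rw [dif_pos hG]
      refine Finset.sum_eq_single (⟨v, hG⟩ : G) ?_ ?_
      · intro w hw hne
        have hwv : (w : V) = v := congrArg Subtype.val (Finset.mem_filter.mp hw).2
        exact absurd (Subtype.ext hwv) hne
      · intro hn
        exact (hn (Finset.mem_filter.mpr ⟨Finset.mem_univ _, rfl⟩)).elim
    · rw [dif_neg hG]
      refine Finset.sum_eq_zero fun w hw => ?_
      have : (w : V) = v := congrArg Subtype.val (Finset.mem_filter.mp hw).2
      exact absurd (this ▸ w.2) hG
  · rw [dif_neg hF, dif_neg fun hG => hF (h hG)]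

theorem faceMonomial_map {K G F : Finset V} (h : G ⊆ F) (α : K →₀ ℕ) (x : stdSimplex ℝ G) :
    faceMonomial α F (stdSimplex.map (Set.inclusion (Finset.coe_subset.mpr h)) x) =
      faceMonomial α G x :=
  Finset.prod_congr rfl fun k _ => congrArg (· ^ α k) (faceCoord_map h x k)

theorem faceMonomial_self {K : Finset V} (α : K →₀ ℕ) (x : stdSimplex ℝ K) :
    faceMonomial α K x = ∏ k, x k ^ α k := by
  simp [faceMonomial, faceCoord]

theorem faceMonomial_eq_zero {K F : Finset V} {α : K →₀ ℕ} {k : K} (hα : α k ≠ 0)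
    (hk : (k : V) ∉ F) (x : stdSimplex ℝ F) : faceMonomial α F x = 0 := by
  refine Finset.prod_eq_zero (Finset.mem_univ k) ?_
  rw [faceCoord, dif_neg hk, zero_pow hα]

theorem exists_eval_eq_faceMonomial {K : Finset V} (α : K →₀ ℕ) (F : Finset V) :
    ∃ P : MvPolynomial F ℝ, P.totalDegree ≤ ∑ k, α k ∧
      ∀ x : stdSimplex ℝ F, faceMonomial α F x = MvPolynomial.eval (x : F → ℝ) P := by
  refine ⟨∏ k : K, (if h : (k : V) ∈ F then MvPolynomial.X ⟨k, h⟩ else 0) ^ α k, ?_, fun x => ?_⟩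
  · refine (MvPolynomial.totalDegree_finsetProd _ _).trans (Finset.sum_le_sum fun k _ => ?_)
    refine (MvPolynomial.totalDegree_pow _ _).trans ?_
    refine (Nat.mul_le_mul_left (α k) ?_).trans (mul_one _).le
    split_ifs
    · exact (MvPolynomial.totalDegree_X _).le
    · simp
  · rw [map_prod]
    refine Finset.prod_congr rfl fun k _ => ?_
    rw [map_pow, faceCoord]
    split_ifs
    · rw [MvPolynomial.eval_X]
    · simp

/-- Monomials of one positive degree on the face `L` of `K` are linearly independent. -/
theorem coeff_eq_zero_of_faceMonomial_sum {K L : Finset V} {r : ℕ} (hr : r ≠ 0)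
    (hLK : L ⊆ K) (c : (K →₀ ℕ) → ℝ)
    (h : ∀ x : stdSimplex ℝ L,
      ∑ α ∈ Finset.univ.finsuppAntidiag r, faceMonomial α L x * c α = 0)
    {α : K →₀ ℕ} (hα : α ∈ Finset.univ.finsuppAntidiag r) (hαL : ∀ k, α k ≠ 0 → (k : V) ∈ L) :
    c α = 0 := by
  classical
  have hdeg : ∀ α : K →₀ ℕ, α ∈ Finset.univ.finsuppAntidiag r → ∑ k, α k = r :=
    fun α hα => (Finset.mem_finsuppAntidiag.mp hα).1
  -- On an empty face `h` is vacuous; but then `hαL` forces α = 0, which contradicts r ≠ 0.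
  have hL : L.Nonempty := by
    by_contra hL
    rw [Finset.not_nonempty_iff_eq_empty] at hL
    subst hL
    refine hr (hdeg α hα ▸ Finset.sum_eq_zero fun k _ => ?_)
    by_contra hk
    exact absurd (hαL k hk) (Finset.notMem_empty _)
  let B := (Finset.univ.finsuppAntidiag r).filter fun α : K →₀ ℕ => ∀ k, α k ≠ 0 → (k : V) ∈ L
  let P : MvPolynomial K ℝ := ∑ α ∈ B, MvPolynomial.monomial α (c α)
  have hP : P = 0 := by
    -- It suffices to test on the positive orthant: dividing by the coordinate sum over `L` lands in
    -- the simplex and, by homogeneity, changes the value only by the factor s^(-r).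
    refine MvPolynomial.funext_set (fun _ => Set.Ioi (0 : ℝ)) (fun _ => Set.Ioi_infinite 0)
      fun y hy => ?_
    have hy0 : ∀ k, 0 < y k := fun k => hy k (Set.mem_univ k)
    let z : L → ℝ := fun l => y ⟨l, hLK l.2⟩
    let s : ℝ := ∑ l, z l
    have hs : 0 < s := Finset.sum_pos (fun l _ => hy0 _) (by
      obtain ⟨v, hv⟩ := hL
      exact ⟨⟨v, hv⟩, Finset.mem_univ _⟩)
    let x : stdSimplex ℝ L := ⟨fun l => z l / s, fun l => (div_pos (hy0 _) hs).le, by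
      rw [← Finset.sum_div, div_self hs.ne']⟩
    have hx : ∀ α ∈ B, faceMonomial α L x = (s ^ r)⁻¹ * ∏ k, y k ^ α k := fun α hα => by
      obtain ⟨hα1, hα2⟩ := Finset.mem_filter.mp hα
      rw [← hdeg α hα1, ← Finset.prod_pow_eq_pow_sum, ← Finset.prod_inv_distrib,
        ← Finset.prod_mul_distrib]
      refine Finset.prod_congr rfl fun k _ => ?_
      by_cases hk : α k = 0
      · simp [hk]
      · rw [faceCoord, dif_pos (hα2 k hk), ← inv_pow, ← mul_pow]
        congr 1
        change y k / s = _
        rw [div_eq_inv_mul]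
    have hsum := h x
    rw [← Finset.sum_filter_add_sum_filter_not _
      (fun α : K →₀ ℕ => ∀ k, α k ≠ 0 → (k : V) ∈ L)] at hsum
    rw [Finset.sum_eq_zero (s := Finset.filter (fun α : K →₀ ℕ => ¬ _) _), add_zero,
      Finset.sum_congr rfl fun α hα => by rw [hx α hα, mul_assoc], ← Finset.mul_sum] at hsum
    · have := (mul_eq_zero.mp hsum).resolve_left (inv_ne_zero (pow_ne_zero _ hs.ne'))
      rw [map_zero, map_sum, ← this]
      refine Finset.sum_congr rfl fun α _ => ?_
      rw [MvPolynomial.eval_monomial, Finsupp.prod_fintype _ _ (by simp), mul_comm]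
    · intro α hα
      obtain ⟨-, hα2⟩ := Finset.mem_filter.mp hα
      push Not at hα2
      obtain ⟨k, hk, hkL⟩ := hα2
      rw [faceMonomial_eq_zero hk hkL, zero_mul]
  have hc : MvPolynomial.coeff α P = c α := by
    simp only [P, MvPolynomial.coeff_sum, MvPolynomial.coeff_monomial]
    rw [Finset.sum_ite_eq' B α, if_pos (Finset.mem_filter.mpr ⟨hα, hαL⟩)]
  rw [← hc, hP, MvPolynomial.coeff_zero]

/-- The vertex map `F → K` that acts as `σ` on common vertices and sends all others to `i`. -/
def vertexMap {K : Finset V} (σ : K → K) (i : K) (F : Finset V) : F → K :=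
  fun v => if h : (v : V) ∈ K then σ ⟨v, h⟩ else i

theorem vertexMap_self {K : Finset V} (σ : K → K) (i : K) : vertexMap σ i K = σ := by
  funext v
  simp [vertexMap]

/-- Such a map factors through the face K ∩ F, so the pullback passes through the trace there. -/
theorem pullback_eq_zero_of_forall_mem {p q : ℕ} {K F : Finset V} {f : F → K}
    (hf : ∀ v, (f v : V) ∈ F) {ω : DoubleCovector p q (simplexTangent K)}
    (hω : DoubleCovector.pullback p q (simplexTangentMap
      (Set.inclusion (Finset.coe_subset.mpr (Finset.inter_subset_left : K ∩ F ⊆ K)))) ω = 0) :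
    DoubleCovector.pullback p q (simplexTangentMap f) ω = 0 := by
  let f' : F → (K ∩ F : Finset V) := fun v => ⟨f v, Finset.mem_inter.mpr ⟨(f v).2, hf v⟩⟩
  have : f = Set.inclusion (Finset.coe_subset.mpr (Finset.inter_subset_left : K ∩ F ⊆ K)) ∘ f' :=
    rfl
  rw [this]
  have h2 := simplexTangentMap_comp f'
    (Set.inclusion (Finset.coe_subset.mpr (Finset.inter_subset_left : K ∩ F ⊆ K)))
  refine (congrArg (fun g => DoubleCovector.pullback p q g ω) h2).trans ?_
  rw [DoubleCovector.pullback_comp]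
  exact (congrArg (DoubleCovector.pullback p q (simplexTangentMap f')) hω).trans (map_zero _)

/-- The extension of `x ^ α • ω` from the simplex `K` to all simplices by means of a vertex map. -/
def extendMonomial {p q : ℕ} {K : Finset V} (α : K →₀ ℕ) (σ : K → K) (i : K)
    (ω : DoubleCovector p q (simplexTangent K)) (F : Finset V) : DoubleForm p q F :=
  fun x => faceMonomial α F x •
    DoubleCovector.pullback p q (simplexTangentMap (vertexMap σ i F)) ω

/-- Families of polynomial forms on all simplices that are compatible with traces. -/
def compatibleFamilies (r p q m : ℕ) (V : Type*) :
    Submodule ℝ (∀ F : Finset V, DoubleForm p q F) where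
  carrier := {Φ | (∀ F : Finset V, Φ F ∈ poly r p q m F) ∧ ∀ (G F : Finset V) (h : G ⊆ F),
    trace p q h (Φ F) = Φ G}
  zero_mem' := ⟨fun F => Submodule.zero_mem _, fun G F h => by simp⟩
  add_mem' := fun h1 h2 => ⟨fun F => Submodule.add_mem _ (h1.1 F) (h2.1 F),
    fun G F h => by simp [h1.2 G F h, h2.2 G F h]⟩
  smul_mem' := fun c Φ h1 => ⟨fun F => Submodule.smul_mem _ c (h1.1 F),
    fun G F h => by simp [h1.2 G F h]⟩

/-- Both the monomial and the vertex map on a face are restrictions of those on the larger simplex,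
so compatibility is functoriality and holds for every `σ` and `i`. -/
theorem extendMonomial_mem {r p q m : ℕ} {K : Finset V} {α : K →₀ ℕ} (hα : ∑ k, α k ≤ r)
    (σ : K → K) (i : K) {ω : DoubleCovector p q (simplexTangent K)}
    (hω : ω ∈ DoubleCovector.summand p q m (simplexTangent K)) :
    extendMonomial α σ i ω ∈ compatibleFamilies r p q m V := by
  refine ⟨fun F => ?_, fun G F h => ?_⟩
  · obtain ⟨P, hP, hP'⟩ := exists_eval_eq_faceMonomial α F
    exact smul_const_mem_poly (hP.trans hα) hP' (DoubleCovector.pullback_mem_summand _ hω)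
  · funext x
    change DoubleCovector.pullback p q _ (faceMonomial α F _ • _) = _
    rw [map_smul, faceMonomial_map h]
    have h2 := simplexTangentMap_comp (Set.inclusion (Finset.coe_subset.mpr h))
      (vertexMap σ i F)
    exact congrArg (fun g => faceMonomial α G x • DoubleCovector.pullback p q g ω) h2.symm

/-- A form of positive degree with vanishing trace extends to a compatible family that vanishes on
the simplices not containing the given one. -/
theorem exists_extension_of_ne_zero {r p q m : ℕ} (hr : r ≠ 0) {K : Finset V}
    {φ : DoubleForm p q K} (hφ : φ ∈ poly r p q m K)
    (htr : ∀ (L : Finset V) (h : L ⊂ K), trace p q h.subset φ = 0) :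
    ∃ Φ ∈ compatibleFamilies r p q m V, Φ K = φ ∧ ∀ F, ¬K ⊆ F → Φ F = 0 := by
  obtain ⟨ω, hω, hφω⟩ := exists_monomial_expansion hφ
  have hdeg : ∀ α : K →₀ ℕ, α ∈ Finset.univ.finsuppAntidiag r → ∑ k, α k = r :=
    fun α hα => (Finset.mem_finsuppAntidiag.mp hα).1
  -- The weights α_j / r sum to 1 and are zero off the support of α, so only admissible target
  -- vertices `j` occur.
  refine ⟨∑ α ∈ Finset.univ.finsuppAntidiag r, ∑ j : K,
    ((α j : ℝ) / r) • extendMonomial α id j (ω α), Submodule.sum_mem _ fun α hα =>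
      Submodule.sum_mem _ fun j _ => Submodule.smul_mem _ _
        (extendMonomial_mem (hdeg α hα).le id j (hω α)), ?_, fun F hKF => ?_⟩
  · funext x
    rw [hφω x]
    simp only [Finset.sum_apply, Pi.smul_apply]
    refine Finset.sum_congr rfl fun α hα => ?_
    have h1 : ∀ j : K, extendMonomial α id j (ω α) K x = (∏ k, x k ^ α k) • ω α := fun j => by
      rw [extendMonomial, vertexMap_self, simplexTangentMap_id, faceMonomial_self]
      rfl
    simp only [h1]
    rw [← Finset.sum_smul, ← Finset.sum_div, ← Nat.cast_sum, hdeg α hα,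
      div_self (Nat.cast_ne_zero.mpr hr), one_smul]
  · have hL : K ∩ F ⊂ K := Finset.inter_subset_left.ssubset_of_ne fun h =>
      hKF (Finset.inter_eq_left.mp h)
    -- Monomials supported in K ∩ F are independent there, so the vanishing trace kills each of
    -- their coefficients separately.
    have hzero : ∀ α : K →₀ ℕ, α ∈ Finset.univ.finsuppAntidiag r → (∀ k, α k ≠ 0 → (k : V) ∈ K ∩ F) →
        DoubleCovector.pullback p q (simplexTangentMap
          (Set.inclusion (Finset.coe_subset.mpr hL.subset))) (ω α) = 0 := by
      intro α hα hαL
      ext X Y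
      refine coeff_eq_zero_of_faceMonomial_sum hr hL.subset (fun α : K →₀ ℕ =>
        DoubleCovector.pullback p q (simplexTangentMap
          (Set.inclusion (Finset.coe_subset.mpr hL.subset))) (ω α) X Y) (fun x => ?_) hα hαL
      have h0 := congrArg (DoubleCovector.evalAt X Y) (congrFun (htr _ hL) x)
      change DoubleCovector.evalAt X Y (DoubleCovector.pullback p q _ (φ _)) = 0 at h0
      rw [hφω, map_sum, map_sum] at h0
      rw [← h0]
      refine Finset.sum_congr rfl fun α _ => ?_
      rw [map_smul, map_smul, ← faceMonomial_self, faceMonomial_map hL.subset]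
      rfl
    rw [Finset.sum_apply]
    refine Finset.sum_eq_zero fun α hα => ?_
    rw [Finset.sum_apply]
    refine Finset.sum_eq_zero fun j _ => ?_
    by_cases hj : α j = 0
    · simp [hj]
    funext x
    change ((α j : ℝ) / r) • (faceMonomial α F x •
      DoubleCovector.pullback p q (simplexTangentMap (vertexMap id j F)) (ω α)) = 0
    by_cases hα' : ∀ k, α k ≠ 0 → (k : V) ∈ F
    · rw [pullback_eq_zero_of_forall_mem (fun v => ?_) (hzero α hα fun k hk =>
        Finset.mem_inter.mpr ⟨k.2, hα' k hk⟩), smul_zero, smul_zero]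
      unfold vertexMap
      split_ifs
      · exact v.2
      · exact hα' j hj
    · push Not at hα'
      obtain ⟨k, hk, hkF⟩ := hα'
      rw [faceMonomial_eq_zero hk hkF, zero_smul, smul_zero]

/-- A constant form with vanishing trace extends to a compatible family that vanishes on the
simplices not containing the given one, unless it belongs to the totally antisymmetric summand. -/
theorem exists_extension_of_zero {p q m : ℕ} (hm : m ≠ q) {K : Finset V}
    {φ : DoubleForm p q K} (hφ : φ ∈ poly 0 p q m K)
    (htr : ∀ (L : Finset V) (h : L ⊂ K), trace p q h.subset φ = 0) :
    ∃ Φ ∈ compatibleFamilies 0 p q m V, Φ K = φ ∧ ∀ F, ¬K ⊆ F → Φ F = 0 := by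
  obtain ⟨ω, hω, hφω⟩ : ∃ ω ∈ DoubleCovector.summand p q m (simplexTangent K), ∀ x, φ x = ω := by
    obtain ⟨ω, hω, h⟩ := exists_monomial_expansion hφ
    exact ⟨ω 0, hω 0, fun x => by simpa using h x⟩
  have hc : 2 * ((q : ℝ) - m) * (p + 1 + m) ≠ 0 := by
    have h1 : (q : ℝ) - m ≠ 0 := sub_ne_zero.mpr (Nat.cast_injective.ne hm.symm)
    have h2 : (p : ℝ) + 1 + m ≠ 0 := by positivity
    exact mul_ne_zero (mul_ne_zero two_ne_zero h1) h2
  have hmem : ∀ (σ : K → K) (i : K),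
      extendMonomial 0 σ i ω ∈ compatibleFamilies 0 p q m V := fun σ i =>
    extendMonomial_mem (by simp) σ i hω
  have happ : ∀ (σ : K → K) (i : K) (F : Finset V) (x : stdSimplex ℝ F),
      extendMonomial 0 σ i ω F x =
        DoubleCovector.pullback p q (simplexTangentMap (vertexMap σ i F)) ω := fun σ i F x => by
    simp [extendMonomial, faceMonomial]
  refine ⟨(2 * ((q : ℝ) - m) * (p + 1 + m))⁻¹ • ∑ i : K, ∑ j : K,
    (extendMonomial 0 (Equiv.swap i j) i ω + (-1 : ℝ) • extendMonomial 0 (Function.update id i j) i ω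
      + (-1 : ℝ) • extendMonomial 0 (Function.update id j i) i ω + extendMonomial 0 id i ω),
    Submodule.smul_mem _ _ (Submodule.sum_mem _ fun i _ => Submodule.sum_mem _ fun j _ =>
      Submodule.add_mem _ (Submodule.add_mem _ (Submodule.add_mem _ (hmem _ i)
        (Submodule.smul_mem _ _ (hmem _ i))) (Submodule.smul_mem _ _ (hmem _ i))) (hmem _ i)),
    ?_, fun F hKF => ?_⟩
  · funext x
    have hsum := DoubleCovector.sum_pullback_vertices hω
    have hsub : ∀ a b c d : DoubleCovector p q (simplexTangent K),
        a + (-1 : ℝ) • b + (-1 : ℝ) • c + d = a - b - c + d := fun a b c d => by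
      ext X Y
      change a X Y + -1 * b X Y + -1 * c X Y + d X Y = a X Y - b X Y - c X Y + d X Y
      ring
    rw [hφω x]
    simp only [Pi.smul_apply, Finset.sum_apply, Pi.add_apply, happ, vertexMap_self]
    rw [inv_smul_eq_iff₀ hc, ← hsum]
    exact Finset.sum_congr rfl fun i _ => Finset.sum_congr rfl fun j _ => hsub _ _ _ _
  · have hL : K ∩ F ⊂ K := Finset.inter_subset_left.ssubset_of_ne fun h =>
      hKF (Finset.inter_eq_left.mp h)
    have hvm : ∀ (σ τ : K → K) (i : K), (∀ k : K, (k : V) ∈ F → σ k = τ k) →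
        vertexMap σ i F = vertexMap τ i F := fun σ τ i h => by
      funext v
      unfold vertexMap
      split_ifs with hv
      · exact h ⟨v, hv⟩ v.2
      · rfl
    funext x
    simp only [Pi.smul_apply, Finset.sum_apply, Pi.add_apply, happ]
    rw [Finset.sum_eq_zero fun i _ => Finset.sum_eq_zero fun j _ => ?_, smul_zero]
    · rfl
    -- If both vertices lie in F, each of the four maps sends F into K ∩ F; if one is missing, the
    -- maps agree on F in pairs of opposite sign.
    by_cases hi : (i : V) ∈ F
    · by_cases hj : (j : V) ∈ F
      · have hω0 : DoubleCovector.pullback p q (simplexTangentMap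
            (Set.inclusion (Finset.coe_subset.mpr hL.subset))) ω = 0 := by
          -- The vertex `i` provides a point at which the trace of the constant form can be read
          -- off.
          have : Nonempty (K ∩ F : Finset V) := ⟨⟨i, Finset.mem_inter.mpr ⟨i.2, hi⟩⟩⟩
          let y : stdSimplex ℝ (K ∩ F : Finset V) := Classical.arbitrary _
          have h0 := congrFun (htr _ hL) y
          change DoubleCovector.pullback p q _ (φ _) = 0 at h0
          rwa [hφω] at h0
        have hzero : ∀ σ : K → K, (∀ k : K, (k : V) ∈ F → (σ k : V) ∈ F) →
            DoubleCovector.pullback p q (simplexTangentMap (vertexMap σ i F)) ω = 0 :=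
          fun σ hσ => pullback_eq_zero_of_forall_mem (fun v => by
            unfold vertexMap
            split_ifs with hv
            · exact hσ ⟨v, hv⟩ v.2
            · exact hi) hω0
        rw [hzero _ fun k hk => ?_, hzero _ fun k hk => ?_, hzero _ fun k hk => ?_,
          hzero id fun k hk => hk]
        · simp
        · rw [Function.update_apply]
          split_ifs
          · exact hi
          · exact hk
        · rw [Function.update_apply]
          split_ifs
          · exact hj
          · exact hk
        · rw [Equiv.swap_apply_def]
          split_ifs
          · exact hj
          · exact hi
          · exact hk
      · rw [hvm (Equiv.swap i j) (Function.update id i j) i fun k hk => ?_,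
          hvm (Function.update id j i) id i fun k hk => ?_]
        · module
        · exact Function.update_of_ne (fun h : k = j => hj (h ▸ hk)) _ _
        · have hkj : k ≠ j := fun h => hj (h ▸ hk)
          rw [Equiv.swap_apply_def, Function.update_apply, if_neg hkj]
          rfl
    · rw [hvm (Equiv.swap i j) (Function.update id j i) i fun k hk => ?_,
        hvm (Function.update id i j) id i fun k hk => ?_]
      · module
      · exact Function.update_of_ne (fun h : k = i => hi (h ▸ hk)) _ _
      · have hki : k ≠ i := fun h => hi (h ▸ hk)
        rw [Equiv.swap_apply_def, Function.update_apply, if_neg hki]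
        rfl

end DoubleForm

/-! ### Definiteness of the fibre inner product -/

namespace DoubleCovector

theorem inner_self_nonneg {W : Type*} [AddCommGroup W] [Module ℝ W] [FiniteDimensional ℝ W]
    {p q : ℕ} (g : InnerProductSpace.Core ℝ W) (φ : DoubleCovector p q W) : 0 ≤ inner g φ φ :=
  Finset.sum_nonneg fun _ _ => Finset.sum_nonneg fun _ _ => mul_self_nonneg _

/-- An injective multi-index becomes increasing after a permutation. -/
theorem exists_perm_orderEmb {p n : ℕ} (v : Fin p → Fin n) (hv : Function.Injective v) :
    ∃ (σ : Equiv.Perm (Fin p)) (I : Fin p ↪o Fin n), v ∘ σ = I :=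
  ⟨Tuple.sort v, OrderEmbedding.ofStrictMono (v ∘ Tuple.sort v)
    ((Tuple.monotone_sort v).strictMono_of_injective (hv.comp (Tuple.sort v).injective)), rfl⟩

/-- An alternating map that vanishes on increasing families of basis vectors is zero. -/
theorem _root_.AlternatingMap.eq_zero_of_forall_orderEmb {R M N : Type*} [CommRing R]
    [AddCommGroup M] [Module R M] [AddCommGroup N] [Module R N] {n p : ℕ}
    (b : Module.Basis (Fin n) R M) {f : M [⋀^Fin p]→ₗ[R] N}
    (h : ∀ I : Fin p ↪o Fin n, f (b ∘ I) = 0) : f = 0 := by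
  refine Module.Basis.ext_alternating b fun v hv => ?_
  obtain ⟨σ, I, hI⟩ := exists_perm_orderEmb v hv
  have h1 := f.map_perm (b ∘ v) σ
  rw [Function.comp_assoc, hI, h I] at h1
  rw [AlternatingMap.zero_apply]
  exact (smul_eq_zero_iff_eq _).mp h1.symm

/-- The inner product is a sum of squares over increasing multi-indices, and these determine an
alternating map. -/
theorem eq_zero_of_inner_self_eq_zero {W : Type*} [AddCommGroup W] [Module ℝ W]
    [FiniteDimensional ℝ W] {p q : ℕ} (g : InnerProductSpace.Core ℝ W) {φ : DoubleCovector p q W}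
    (h : inner g φ φ = 0) : φ = 0 := by
  refine AlternatingMap.eq_zero_of_forall_orderEmb (orthonormalBasis g) fun I =>
    AlternatingMap.eq_zero_of_forall_orderEmb (orthonormalBasis g) fun J => ?_
  have h1 := (Finset.sum_eq_zero_iff_of_nonneg fun I _ =>
    Finset.sum_nonneg fun J _ => mul_self_nonneg _).mp h I (Finset.mem_univ I)
  have h2 := (Finset.sum_eq_zero_iff_of_nonneg fun J _ => mul_self_nonneg _).mp h1 J
    (Finset.mem_univ J)
  exact mul_self_eq_zero.mp h2

end DoubleCovector

/-! ### Definiteness of the L² inner product -/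

namespace DoubleForm

variable {ι : Type*} [Fintype ι]

/-- The volume measure of a simplex charges every nonempty open set. -/
instance (g : InnerProductSpace.Core ℝ (simplexTangent ι)) :
    (simplexVolume g).IsOpenPosMeasure := by
  refine ⟨fun U hU hne => ?_⟩
  obtain ⟨x, hx⟩ := hne
  have hι : Nonempty ι := by
    by_contra h
    rw [not_nonempty_iff] at h
    have hx := x.2.2
    simp at hx
  have he := isClosedEmbedding_fromBarycenter (ι := ι)
  rw [simplexVolume, he.measurableEmbedding.comap_apply]
  let n : ℝ := (Fintype.card ι : ℝ)⁻¹
  have hn : 0 < n := inv_pos.mpr (Nat.cast_pos.mpr Fintype.card_pos)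
  have hsum : ∀ v : simplexTangent ι, ∑ i, ((v : ι → ℝ) i + n) = 1 := fun v => by
    rw [Finset.sum_add_distrib, mem_simplexTangent.mp v.2]
    simp [n]
  let ψ : simplexTangent ι → ι → ℝ := fun v i => (v : ι → ℝ) i + n
  have hψ : Continuous ψ := continuous_pi fun i =>
    ((continuous_apply i).comp continuous_subtype_val).add continuous_const
  obtain ⟨U', hU', rfl⟩ := isOpen_induced_iff.mp hU
  let O : Set (simplexTangent ι) := ψ ⁻¹' (U' ∩ ⋂ i, {y | 0 < y i})
  have hO : IsOpen O := (hU'.inter (isOpen_iInter_of_finite fun i =>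
    isOpen_lt continuous_const (continuous_apply i))).preimage hψ
  have hOsub : O ⊆ fromBarycenter '' (Subtype.val ⁻¹' U') := fun v hv => by
    have hv2 : ∀ i, 0 < (v : ι → ℝ) i + n := fun i => Set.mem_iInter.mp hv.2 i
    refine ⟨⟨ψ v, fun i => (hv2 i).le, hsum v⟩, hv.1, Subtype.ext (funext fun i => ?_)⟩
    change (v : ι → ℝ) i + n - n = _
    ring
  -- Moving a point of the open set slightly towards the barycenter makes all its coordinates
  -- positive.
  have hOne : O.Nonempty := by
    let γ : ℝ → ι → ℝ := fun t i => (1 - t) * (x i - n) + n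
    have hγ : Continuous γ := continuous_pi fun i =>
      ((continuous_const.sub continuous_id).mul continuous_const).add continuous_const
    have h0 : γ 0 ∈ U' := by
      have : γ 0 = x := funext fun i => by simp [γ]
      rw [this]
      exact hx
    have hev : ∀ᶠ t in nhdsWithin (0 : ℝ) (Set.Ioi 0), γ t ∈ U' :=
      nhdsWithin_le_nhds ((hU'.preimage hγ).mem_nhds h0)
    obtain ⟨t, ⟨htU, ht0⟩, ht1⟩ := ((hev.and self_mem_nhdsWithin).and
      (nhdsWithin_le_nhds (Iio_mem_nhds (zero_lt_one' ℝ)))).exists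
    refine ⟨(1 - t) • fromBarycenter x, htU, Set.mem_iInter.mpr fun i => ?_⟩
    change 0 < (1 - t) * (x i - n) + n
    have hxi : 0 ≤ x i := x.2.1 i
    nlinarith [mul_nonneg (sub_nonneg.mpr ht1.le) hxi, mul_pos ht0 hn]
  exact ((hO.measure_pos _ hOne).trans_le (measure_mono hOsub)).ne'

/-- The `L²` inner product is definite on polynomial double forms. -/
theorem eq_zero_of_l2Inner_self_eq_zero {r p q m : ℕ}
    (g : InnerProductSpace.Core ℝ (simplexTangent ι)) {φ : DoubleForm p q ι}
    (hφ : φ ∈ poly r p q m ι) (h : l2Inner g φ φ = 0) : φ = 0 := by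
  have hc : Continuous fun x => DoubleCovector.inner g (φ x) (φ x) :=
    continuous_finsetSum _ fun I _ => continuous_finsetSum _ fun J _ =>
      (continuous_coeff hφ _ _).mul (continuous_coeff hφ _ _)
  have h1 := (integral_eq_zero_iff_of_nonneg
    (fun x => DoubleCovector.inner_self_nonneg g (φ x)) (integrable_inner g hφ hφ)).mp h
  have h2 := (hc.ae_eq_iff_eq _ continuous_const).mp h1
  exact funext fun x => DoubleCovector.eq_zero_of_inner_self_eq_zero g (congrFun h2 x)

end DoubleForm

/-! ### The triangularity argument and the theorem -/

/-- The dual of a space of compatible families is the direct sum of the dual images of the spaces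
of traces that vanish on the boundary, provided that these traces extend. -/
theorem isInternal_dual_of_extension {ι W : Type*} [Finite ι] [PartialOrder ι] [DecidableEq ι]
    [AddCommMonoid W] [Module ℝ W] [Module.Finite ℝ W] (P : ι → Type*)
    [∀ i, AddCommMonoid (P i)] [∀ i, Module ℝ (P i)] (tr : ∀ i, W →ₗ[ℝ] P i)
    (P₀ : ∀ i, Submodule ℝ (P i)) (B : ∀ i, P i →ₗ[ℝ] Module.Dual ℝ (P i))
    (hB : ∀ i (φ : P i), B i φ φ = 0 → φ = 0)
    (hker : ∀ w, (∀ i, tr i w = 0) → w = 0)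
    (hmem : ∀ i w, (∀ j < i, tr j w = 0) → tr i w ∈ P₀ i)
    (hext : ∀ i, ∀ φ ∈ P₀ i, ∃ w, tr i w = φ ∧ ∀ j, ¬i ≤ j → tr j w = 0) :
    DirectSum.IsInternal fun i => ((P₀ i).map (B i)).map (tr i).dualMap := by
  rw [DirectSum.isInternal_submodule_iff_iSupIndep_and_iSup_eq_top]
  constructor
  · rw [iSupIndep_iff_finsetSum_eq_zero_imp_eq_zero]
    -- Downward induction: the relation is evaluated on the extension of φ. Components above i
    -- vanish by induction, those not above i because the extension does, leaving only the product
    -- of φ with itself.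
    intro s f hf hsum i
    induction i using (wellFounded_gt (α := ι)).induction with
    | _ i ih =>
      intro hi
      obtain ⟨-, ⟨φ, hφ, rfl⟩, hfi⟩ := hf i hi
      obtain ⟨w, hw, hw0⟩ := hext i φ hφ
      have h1 : ∑ j ∈ s, f j w = 0 := by
        rw [← LinearMap.sum_apply, hsum, LinearMap.zero_apply]
      rw [Finset.sum_eq_single_of_mem i hi fun j hj hji => ?_] at h1
      · rw [← hfi] at h1 ⊢
        rw [LinearMap.dualMap_apply, hw] at h1
        rw [hB i φ h1]
        simp
      · by_cases hij : i ≤ j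
        · rw [ih j (lt_of_le_of_ne hij (Ne.symm hji)) hj, LinearMap.zero_apply]
        · obtain ⟨-, ⟨χ, hχ, rfl⟩, hfj⟩ := hf j hj
          rw [← hfj, LinearMap.dualMap_apply, hw0 j hij, map_zero]
  -- Upward induction: if all lower traces of `w` vanish, its trace at i lies in `P₀ i` and can be
  -- tested against itself.
  · refine Submodule.eq_top_of_forall_dual_eq_zero _ fun w hw => hker w fun i => ?_
    induction i using (wellFounded_lt (α := ι)).induction with
    | _ i ih =>
      have h1 := hmem i w ih
      refine hB i _ ?_
      exact hw ((tr i).dualMap (B i (tr i w))) (Submodule.mem_iSup_of_mem i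
        (Submodule.mem_map_of_mem (Submodule.mem_map_of_mem h1)))

end

theorem mainTheorem4 {V : Type*} [DecidableEq V] (T : PreAbstractSimplicialComplex V) [Finite T]
    (g : ∀ F : T, InnerProductSpace.Core ℝ (simplexTangent (F : Finset V)))
    (r p q m : ℕ) (hrm : (r, m) ≠ (0, q)) :
    DirectSum.IsInternal fun F : T =>
      (DoubleForm.dagger r p q m (F : Finset V) (g F)).map (globalTrace r p q m T F).dualMap := by
  have hfin : Module.Finite ℝ (globalSpace r p q m T) := Submodule.finite_of_finite _
  refine isInternal_dual_of_extension (fun F : T => DoubleForm.poly r p q m (F : Finset V))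
    (globalTrace r p q m T) (fun F => DoubleForm.vanishingTrace r p q m (F : Finset V))
    (fun F => DoubleForm.l2Functional r p q m (g F)) (fun F φ h => ?_) (fun w h => ?_)
    (fun F w h L hL => ?_) fun F φ hφ => ?_
  · exact Subtype.ext (DoubleForm.eq_zero_of_l2Inner_self_eq_zero (g F) φ.2 h)
  · exact Subtype.ext (funext h)
  · by_cases hne : L.Nonempty
    · have hLT : L ∈ T := (T.isRelLowerSet_faces F.2).2 hL.subset hne
      have h1 := w.2 ⟨L, hLT⟩ F hL.subset
      refine h1.trans ?_
      exact congrArg Subtype.val (h ⟨L, hLT⟩ hL)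
    -- The empty face is not a simplex of `T`, but it has no points, so the trace on it is trivially
    -- zero.
    · rw [Finset.not_nonempty_iff_eq_empty] at hne
      subst hne
      funext x
      have hx := x.2.2
      simp at hx
  · obtain ⟨Φ, hΦ, hΦF, hΦ0⟩ : ∃ Φ ∈ DoubleForm.compatibleFamilies r p q m V,
        Φ F = (φ : DoubleForm p q (F : Finset V)) ∧
          ∀ G, ¬(F : Finset V) ⊆ G → Φ G = 0 := by
      by_cases hr : r = 0
      · subst hr
        exact DoubleForm.exists_extension_of_zero (fun h => hrm (by rw [h])) φ.2 hφ
      · exact DoubleForm.exists_extension_of_ne_zero hr φ.2 hφ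
    exact ⟨⟨fun G => ⟨Φ G, hΦ.1 G⟩, fun G G' h => hΦ.2 G G' h⟩, Subtype.ext hΦF,
      fun G hG => Subtype.ext (hΦ0 G hG)⟩
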